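/- Let $(M,d_M)$ be a compact metric space with a finite Borel measure of full support (the integral is written $\int\cdot\,dx$ and the measure of a set $A$ is $|A|$), let $(Y,d_Y)$ be a proper metric space and let $p\ge 1$. Let $b(x,r)>0$ ($x\in M$, $r>0$) be a function, measurable in $x$, and let either $h_\rho(x,y):=\rho$ for all $x,y,\rho$, or $h_\rho(x,y):=d_M(x,y)$ for all $x,y,\rho$. Measurable maps $M\to Y$ are identified when they agree almost everywhere. For a measurable map $u:M\to Y$ and $\rho>0$ put $$e_u^\rho(x):=\frac{1}{b(x,\rho)}\int_{B(x,\rho)\setminus\{x\}}\Big(\frac{d_Y(u(x),u(y))}{h_\rho(x,y)}\Big)^p dy,\qquad E^\rho(u):=\frac12\int_M e_u^\rho(x)\,dx\in[0,\infty],$$ where $B(x,\rho)$ is the open ball. Put $d_{L^p}(u,v):=\big(\int_M d_Y(u(x),v(x))^p\,dx\big)^{1/p}$, and for a measurable map $\xi:M\to Y$ let $L^p_\xi(M,Y)$ be the metric space, with distance $d_{L^p}$, of the measurable maps $u$ with $d_{L^p}(u,\xi)<\infty$. Let $K_{1,M}(r)$ be the supremum, over all subsets $A\subset M$ whose distinct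 points have distance at least $r$ and over all $x\in M$, of the number of $a\in A$ with $x\in B(a,r)$. Assume: - (the $1$-local covering order of $M$ is at most $o(r^{-p})$) there is a function $f$ with $f(r)/r^{-p}\to 0$ as $r\to 0+$ such that $K_{1,M}(r)\le f(r)$ for all $r>0$; - (M) there is a positive function $\Theta(R)$, $R>0$, with $\lim_{R\to0}\Theta(R)=1$, such that $E^R(u)\le\Theta(R)\,E^\rho(u)$ for all $0<\rho\le R/2$ and all measurable maps $u:M\to Y$; - (AR) there is $\kappa\in(0,1]$ such that $\kappa\, b(x,r)\le|B(x,r)|\le b(x,r)$ for all $x\in M$ and $r>0$. Then there is a unique functional $E$ (the energy functional) from the measurable maps $M\to Y$ to $[0,\infty]$ such that for every net $(\rho_i)$ of positive numbers converging to $0$ and every measurable map $\xi:M\to Y$, the functionals $E^{\rho_i}$ compactly converge to $E$ on $L^p_\xi(M,Y)$. This means: - ($\Gamma$-convergence) for every $u\in L^p_\xi(M,Y)$ there is a net $u_i\to u$ in $L^p_\xi(M,Y)$ with $E^{\rho_i}(u_i)\to E(u)$, and $E(u)\le\liminf_i E^{\rho_i}(u_i)$ for every net $u_i\to u$ in $L^p_\xi(M,Y)$;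 - (asymptotic compactness) every net $(u_i)$ in $L^p_\xi(M,Y)$ for which $d_{L^p}(u_i,o_i)$ is bounded for some convergent net $(o_i)$ in $L^p_\xi(M,Y)$, and for which $\limsup_i E^{\rho_i}(u_i)<\infty$, has a subnet that converges in $L^p_\xi(M,Y)$. -/

import Mathlib

open Filter Topology MeasureTheory
open scoped ENNReal NNReal

universe u v w

namespace VarConv

section LocalCoveringOrder

/-- The order of an indexed family `U` of subsets of `S`: the supremum over `x ∈ S` of the number
of members of the family that contain `x`. -/
noncomputable def coverOrder {ι S : Type*} (U : ι → Set S) : ℕ∞ :=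
  ⨆ x : S, {i | x ∈ U i}.encard

/-- `K_{c,S}(r)`: the largest order of a family `{B(a, c r)}_{a ∈ A}` of open balls, where `A` runs
over all subsets of `S` whose distinct points are at distance at least `r`. -/
noncomputable def coverK (S : Type*) [MetricSpace S] (c r : ℝ) : ℕ∞ :=
  ⨆ A : {A : Set S // ∀ a ∈ A, ∀ a' ∈ A, a ≠ a' → r ≤ dist a a'},
    coverOrder (fun a : A.1 => Metric.ball (a : S) (c * r))

/-- The `c`-local covering order of `S` is at most `f(r)`. -/
def LocalCoveringOrderAtMost (S : Type*) [MetricSpace S] (c : ℝ) (f : ℝ → ℝ) : Prop :=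
  ∀ r : ℝ, 0 < r → (coverK S c r : ℝ≥0∞) ≤ ENNReal.ofReal (f r)

end LocalCoveringOrder

section LpMaps

variable {M : Type u} {Y : Type v} [MeasurableSpace M] [MetricSpace Y]

/-- The `L^p`-distance `(∫ d_Y(u(x), v(x))^p dx)^{1/p}`, with values in `[0, ∞]`, of two
(almost everywhere classes of) measurable maps. -/
noncomputable def lpDist (μ : Measure M) (p : ℝ) (f g : M →ₘ[μ] Y) : ℝ≥0∞ :=
  (∫⁻ x, edist (f x) (g x) ^ p ∂μ) ^ (1 / p)

/-- `L^p_ξ(M, Y)`: the (classes of) measurable maps at finite `L^p`-distance from `ξ`. -/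
def LpMap (μ : Measure M) (p : ℝ) (ξ : M →ₘ[μ] Y) : Type (max u v) :=
  {f : M →ₘ[μ] Y // lpDist μ p f ξ < ⊤}

theorem lpDist_self (μ : Measure M) (p : ℝ) (hp : 1 ≤ p) (f : M →ₘ[μ] Y) :
    lpDist μ p f f = 0 := by
  have h0 : 0 < p := by linarith
  simp [lpDist, ENNReal.zero_rpow_of_pos, h0]

theorem lpDist_comm (μ : Measure M) (p : ℝ) (f g : M →ₘ[μ] Y) :
    lpDist μ p f g = lpDist μ p g f := by
  simp [lpDist, edist_comm]

theorem lpDist_triangle (μ : Measure M) (p : ℝ) (hp : 1 ≤ p) (f g k : M →ₘ[μ] Y) :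
    lpDist μ p f k ≤ lpDist μ p f g + lpDist μ p g k := by
  have h0 : 0 < p := by linarith
  refine le_trans ?_ (ENNReal.lintegral_Lp_add_le
    (f.aestronglyMeasurable.edist g.aestronglyMeasurable)
    (g.aestronglyMeasurable.edist k.aestronglyMeasurable) hp)
  unfold lpDist
  gcongr
  exact edist_triangle _ _ _

theorem eq_of_lpDist_eq_zero (μ : Measure M) (p : ℝ) (hp : 1 ≤ p) (f g : M →ₘ[μ] Y)
    (h : lpDist μ p f g = 0) : f = g := by
  have h0 : 0 < p := by linarith
  unfold lpDist at h
  rw [ENNReal.rpow_eq_zero_iff_of_pos (by positivity), lintegral_eq_zero_iff'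
    ((f.aestronglyMeasurable.edist g.aestronglyMeasurable).pow_const p)] at h
  refine AEEqFun.ext (h.mono fun x hx => ?_)
  simpa [ENNReal.rpow_eq_zero_iff_of_pos h0] using hx

/-- `L^p_ξ(M, Y)` is a metric space with the distance `d_{L^p}`. -/
noncomputable instance (μ : Measure M) (p : ℝ) [hp : Fact (1 ≤ p)] (ξ : M →ₘ[μ] Y) :
    MetricSpace (LpMap μ p ξ) :=
  letI : EMetricSpace (LpMap μ p ξ) :=
    { edist := fun f g => lpDist μ p f.1 g.1
      edist_self := fun f => lpDist_self μ p hp.out f.1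
      edist_comm := fun f g => lpDist_comm μ p f.1 g.1
      edist_triangle := fun f g k => lpDist_triangle μ p hp.out f.1 g.1 k.1
      eq_of_edist_eq_zero := fun {f g} h =>
        Subtype.ext (eq_of_lpDist_eq_zero μ p hp.out f.1 g.1 h) }
  EMetricSpace.toMetricSpace fun f g => ne_of_lt <|
    lt_of_le_of_lt (lpDist_triangle μ p hp.out f.1 ξ g.1)
      (ENNReal.add_lt_top.2 ⟨f.2, by rw [lpDist_comm]; exact g.2⟩)

end LpMaps

section Convergence

/-! Convergence of nets of functionals `F i : X → [0, ∞]` on a metric space `X`; a net is indexed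
by a nonempty directed preorder `ι`. -/

variable {ι : Type w} [Preorder ι] {X : Type u} [MetricSpace X]

/-- `F` `Γ`-converges to `E`. -/
def GammaConverges (F : ι → X → ℝ≥0∞) (E : X → ℝ≥0∞) : Prop :=
  (∀ x : X, ∃ a : ι → X, Tendsto a atTop (𝓝 x) ∧
    Tendsto (fun i => F i (a i)) atTop (𝓝 (E x))) ∧
  (∀ (x : X) (a : ι → X), Tendsto a atTop (𝓝 x) →
    E x ≤ liminf (fun i => F i (a i)) atTop)

/-- A net is bounded if it stays at bounded distance from some convergent net. -/
def BoundedNet (a : ι → X) : Prop :=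
  ∃ (o : ι → X) (x : X), Tendsto o atTop (𝓝 x) ∧ ∃ C : ℝ, ∀ i, dist (a i) (o i) ≤ C

/-- The net `a` has a convergent subnet. -/
def HasConvergentSubnet (a : ι → X) : Prop :=
  ∃ (J : Type w) (_ : Preorder J) (_ : IsDirectedOrder J) (_ : Nonempty J) (φ : J → ι),
    Tendsto φ atTop atTop ∧ ∃ x : X, Tendsto (a ∘ φ) atTop (𝓝 x)

/-- Asymptotic compactness of a net of functionals. -/
def AsymptoticallyCompact (F : ι → X → ℝ≥0∞) : Prop :=
  ∀ a : ι → X, BoundedNet a → limsup (fun i => F i (a i)) atTop < ⊤ → HasConvergentSubnet a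

/-- Compact convergence: `Γ`-convergence together with asymptotic compactness. -/
def CompactlyConverges (F : ι → X → ℝ≥0∞) (E : X → ℝ≥0∞) : Prop :=
  GammaConverges F E ∧ AsymptoticallyCompact F

end Convergence

section Energy

variable {M : Type u} {Y : Type v} [MetricSpace M] [MeasurableSpace M] [MetricSpace Y]

/-- The `ρ`-approximating energy density
`e_u^ρ(x) = b(x,ρ)⁻¹ ∫_{B(x,ρ) \ {x}} (d_Y(u(x),u(y)) / h_ρ(x,y))^p dy`. -/
noncomputable def energyDensity (μ : Measure M) (p : ℝ) (b : M → ℝ → ℝ) (h : ℝ → M → M → ℝ)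
    (ρ : ℝ) (f : M → Y) (x : M) : ℝ≥0∞ :=
  (ENNReal.ofReal (b x ρ))⁻¹ *
    ∫⁻ y in Metric.ball x ρ \ {x}, (edist (f x) (f y) / ENNReal.ofReal (h ρ x y)) ^ p ∂μ

/-- The `ρ`-approximating energy `E^ρ(u) = ½ ∫ e_u^ρ(x) dx ∈ [0, ∞]`. -/
noncomputable def approxEnergy (μ : Measure M) (p : ℝ) (b : M → ℝ → ℝ) (h : ℝ → M → M → ℝ)
    (ρ : ℝ) (f : M →ₘ[μ] Y) : ℝ≥0∞ :=
  2⁻¹ * ∫⁻ x, energyDensity μ p b h ρ f x ∂μ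

/-- Condition (M): almost monotonicity of the approximating energies in the radius, with a constant
`Θ(R)` that tends to `1` as `R → 0`. It is the inequality between the integrals over `M` of the
densities, hence a weaker requirement than the inequality `e_u^R ≤ Θ(R) e_u^ρ` almost everywhere
(see `conditionM_of_ae`). -/
def ConditionM (Y : Type v) [MetricSpace Y] (μ : Measure M) (p : ℝ) (b : M → ℝ → ℝ)
    (h : ℝ → M → M → ℝ) : Prop :=
  ∃ Θ : ℝ → ℝ, (∀ R, 0 < R → 0 < Θ R) ∧ Tendsto Θ (𝓝[>] 0) (𝓝 1) ∧
    ∀ ρ R : ℝ, 0 < ρ → ρ ≤ R / 2 → ∀ f : M →ₘ[μ] Y,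
      approxEnergy μ p b h R f ≤ ENNReal.ofReal (Θ R) * approxEnergy μ p b h ρ f

/-- The pointwise almost everywhere form of the inequality implies `ConditionM`. -/
theorem conditionM_of_ae (μ : Measure M) (p : ℝ) (b : M → ℝ → ℝ) (h : ℝ → M → M → ℝ)
    (H : ∃ Θ : ℝ → ℝ, (∀ R, 0 < R → 0 < Θ R) ∧ Tendsto Θ (𝓝[>] 0) (𝓝 1) ∧
      ∀ ρ R : ℝ, 0 < ρ → ρ ≤ R / 2 → ∀ f : M →ₘ[μ] Y, ∀ᵐ x ∂μ,
        energyDensity μ p b h R f x ≤ ENNReal.ofReal (Θ R) * energyDensity μ p b h ρ f x) :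
    ConditionM Y μ p b h := by
  obtain ⟨Θ, h1, h2, h3⟩ := H
  refine ⟨Θ, h1, h2, fun ρ R hρ hR f => ?_⟩
  unfold approxEnergy
  rw [mul_left_comm, ← lintegral_const_mul' _ _ ENNReal.ofReal_ne_top]
  gcongr 2⁻¹ * ?_
  exact lintegral_mono_ae (h3 ρ R hρ hR f)

/-- Condition (AR): `κ b(x,r) ≤ |B(x,r)| ≤ b(x,r)` for all `x` and `r > 0`. -/
def ConditionAR (μ : Measure M) (b : M → ℝ → ℝ) : Prop :=
  ∃ κ : ℝ, 0 < κ ∧ κ ≤ 1 ∧ ∀ (x : M) (r : ℝ), 0 < r →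
    ENNReal.ofReal (κ * b x r) ≤ μ (Metric.ball x r) ∧
      μ (Metric.ball x r) ≤ ENNReal.ofReal (b x r)

end Energy

end VarConv

/-! By (M), `E^R(u)` is at most `Θ(R)` times the lower limit of `E^ρ(u)` as `ρ → 0`. Letting `R → 0`
gives limsup ≤ liminf, so `E^ρ(u)` has a limit `E(u)` for every `u` (`ConditionM.exists_tendsto`).
Constant nets are then recovery nets. Fatou's lemma makes each `E^R` lower semicontinuous, so `u_i →
u` implies `E^R(u) ≤ Θ(R) liminf E^{ρ_i}(u_i)`, and `R → 0` yields the Γ-liminf inequality.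
Uniqueness of `E` follows from uniqueness of Γ-limits along a single net.

For asymptotic compactness, pass to an ultrafilter finer than the net. By (M) the energies at every
small fixed scale `R` are eventually bounded by one constant independent of `R`. As `L^p_ξ` is
complete, it suffices to show that the maps are Cauchy along the ultrafilter
(`eventually_lpDist_le`).

Cauchy in measure: let `τ = min(d, 1)` and average `τ(f x, g x) ≤ τ(f x, g y) + τ(g y, g x)` over `y
∈ B(x, R)`. The second average is `O(R)` in `L^1` by the energy bound. The first is the value at `s
= f x` of a function of `(x, s)` built from `g`. With the ball smoothed, these functions are
equi-Lipschitz, so along the ultrafilter they are uniformly Cauchy on `M × K` for compact `K`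
(`eventually_cutoffIntegral_le`), and tightness allows `f x ∈ K` up to small measure. Replacing `g`
by `f` there leaves the average of `τ(f x, f y)`, again `O(R)` (`lintegral_truncDist_le`).

Equi-integrability: the same averaging applied to `d^p` bounds `∫_T d(f, g)^p` by `O(R^p)` plus a
constant depending on `R` times `μ T` (`setLIntegral_edist_rpow_le`). Together the two give Cauchy
in `L^p`. -/

namespace VarConv

/-! ### The spaces of `L^p` maps: almost everywhere convergence and completeness. -/

section LpMaps

variable {M : Type u} {Y : Type v} [MeasurableSpace M] [MetricSpace Y] {μ : Measure M} {p : ℝ}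

theorem measurable_edist_aeEqFun (f g : M →ₘ[μ] Y) : Measurable fun x => edist (f x) (g x) :=
  (f.stronglyMeasurable.edist g.stronglyMeasurable).measurable

theorem lpDist_rpow (hp : 0 < p) (f g : M →ₘ[μ] Y) :
    lpDist μ p f g ^ p = ∫⁻ x, edist (f x) (g x) ^ p ∂μ := by
  rw [lpDist, one_div, ENNReal.rpow_inv_rpow hp.ne']

theorem lpDist_le_iff (hp : 0 < p) (f g : M →ₘ[μ] Y) (c : ℝ≥0∞) :
    lpDist μ p f g ≤ c ↔ ∫⁻ x, edist (f x) (g x) ^ p ∂μ ≤ c ^ p := by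
  rw [← lpDist_rpow hp, ENNReal.rpow_le_rpow_iff hp]

/-- Chebyshev's inequality for the `L^p`-distance. -/
theorem measure_le_edist_le (hp : 0 < p) (f g : M →ₘ[μ] Y) {ε : ℝ≥0∞} (h0 : ε ≠ 0) (h1 : ε ≠ ⊤) :
    μ {x | ε ≤ edist (f x) (g x)} ≤ lpDist μ p f g ^ p / ε ^ p := by
  rw [lpDist_rpow hp]
  refine le_trans (measure_mono fun x hx => ?_) (meas_ge_le_lintegral_div
    ((measurable_edist_aeEqFun f g).pow_const p).aemeasurable (by simp [h0, h1])
    (ENNReal.rpow_ne_top_of_nonneg hp.le h1))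
  exact ENNReal.rpow_le_rpow hx hp.le

/-- The `L^p`-distance is lower semicontinuous under convergence almost everywhere. -/
theorem lpDist_le_of_tendsto_ae (hp : 0 < p) (f g : M →ₘ[μ] Y) (v : ℕ → M →ₘ[μ] Y)
    (hv : ∀ᵐ x ∂μ, Tendsto (fun n => v n x) atTop (𝓝 (g x))) {c : ℝ≥0∞}
    (hc : ∀ᶠ n in atTop, lpDist μ p f (v n) ≤ c) : lpDist μ p f g ≤ c := by
  rw [lpDist_le_iff hp]
  calc ∫⁻ x, edist (f x) (g x) ^ p ∂μ
      = ∫⁻ x, liminf (fun n => edist (f x) (v n x) ^ p) atTop ∂μ := by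
        refine lintegral_congr_ae (hv.mono fun x hx => ?_)
        exact ((ENNReal.continuous_rpow_const.tendsto _).comp
          (tendsto_const_nhds.edist hx)).liminf_eq.symm
    _ ≤ liminf (fun n => ∫⁻ x, edist (f x) (v n x) ^ p ∂μ) atTop :=
        lintegral_liminf_le fun n => (measurable_edist_aeEqFun f (v n)).pow_const p
    _ ≤ c ^ p := liminf_le_of_frequently_le'
        (hc.mono fun n hn => (lpDist_le_iff hp _ _ _).1 hn).frequently

variable [hp : Fact (1 ≤ p)] {ξ : M →ₘ[μ] Y}

theorem LpMap.exists_subseq_tendsto_ae {a : ℕ → LpMap μ p ξ} {c : LpMap μ p ξ}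
    (ha : Tendsto a atTop (𝓝 c)) :
    ∃ n : ℕ → ℕ, StrictMono n ∧
      ∀ᵐ x ∂μ, Tendsto (fun k => (a (n k)).1 x) atTop (𝓝 (c.1 x)) := by
  have h0 : 0 < p := lt_of_lt_of_le one_pos hp.out
  refine TendstoInMeasure.exists_seq_tendsto_ae (f := fun n => ((a n).1 : M → Y)) ?_
  refine tendstoInMeasure_of_ne_top fun ε hε hε' => ?_
  refine tendsto_of_tendsto_of_tendsto_of_le_of_le tendsto_const_nhds (h := fun n =>
    edist (a n) c ^ p / ε ^ p) ?_ (fun n => zero_le) fun n =>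
      measure_le_edist_le h0 (a n).1 c.1 hε.ne' hε'
  have h1 : Tendsto (fun n => edist (a n) c ^ p / ε ^ p) atTop (𝓝 (0 ^ p / ε ^ p)) := by
    refine ENNReal.Tendsto.div_const ?_ (Or.inr (by simp [hε.ne', hε']))
    exact (ENNReal.continuous_rpow_const.tendsto _).comp (tendsto_iff_edist_tendsto_0.1 ha)
  simpa [h0] using h1

/-- The decay `4⁻ⁿ` beats the weight `2ⁿ`: the sum of `(2ⁿ d(a_n, a_{n+1}))^p` is integrable, hence
finite almost everywhere. Each term is at most the sum `S`, so the steps at `x` are at most `S^{1/p}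
/ 2ⁿ`. -/
theorem ae_cauchySeq_of_lpDist_le (a : ℕ → M →ₘ[μ] Y)
    (ha : ∀ n, lpDist μ p (a n) (a (n + 1)) ≤ (4 ^ n)⁻¹) :
    ∀ᵐ x ∂μ, CauchySeq fun n => a n x := by
  have hp1 := hp.out
  have h0 : 0 < p := lt_of_lt_of_le one_pos hp.out
  have hm : ∀ n, Measurable fun x => ((2 : ℝ≥0∞) ^ n * edist (a n x) (a (n + 1) x)) ^ p :=
    fun n => ((measurable_edist_aeEqFun _ _).const_mul _).pow_const p
  have hn : ∀ n, ∫⁻ x, ((2 : ℝ≥0∞) ^ n * edist (a n x) (a (n + 1) x)) ^ p ∂μ ≤ 2⁻¹ ^ n := by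
    intro n
    have h1 := (lpDist_le_iff h0 _ _ _).1 (ha n)
    simp_rw [ENNReal.mul_rpow_of_nonneg _ _ h0.le]
    rw [lintegral_const_mul _ ((measurable_edist_aeEqFun _ _).pow_const p)]
    calc _ ≤ ((2 : ℝ≥0∞) ^ n) ^ p * ((4 ^ n)⁻¹) ^ p := by gcongr
      _ = (2⁻¹ ^ n) ^ p := by
        rw [← ENNReal.mul_rpow_of_nonneg _ _ h0.le]
        congr 1
        rw [ENNReal.inv_pow, ← mul_pow]
        congr 1
        rw [show (4 : ℝ≥0∞) = 2 * 2 by norm_num, ENNReal.mul_inv (by simp) (by simp), ← mul_assoc,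
          ENNReal.mul_inv_cancel (by simp) (by simp), one_mul]
      _ ≤ (2⁻¹ ^ n) ^ (1 : ℝ) := ENNReal.rpow_le_rpow_of_exponent_ge
        (pow_le_one₀ zero_le (by simp)) hp1
      _ = _ := ENNReal.rpow_one _
  have hfin : ∫⁻ x, ∑' n, ((2 : ℝ≥0∞) ^ n * edist (a n x) (a (n + 1) x)) ^ p ∂μ ≠ ⊤ := by
    rw [lintegral_tsum fun n => (hm n).aemeasurable]
    refine ne_top_of_le_ne_top ?_ (ENNReal.tsum_le_tsum hn)
    rw [ENNReal.tsum_geometric]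
    simp
  filter_upwards [ae_lt_top (Measurable.tsum hm) hfin] with x hx
  refine cauchySeq_of_edist_le_geometric_two
    ((∑' n, ((2 : ℝ≥0∞) ^ n * edist (a n x) (a (n + 1) x)) ^ p) ^ p⁻¹)
    (ENNReal.rpow_ne_top_of_nonneg (by positivity) hx.ne) fun n => ?_
  rw [ENNReal.le_div_iff_mul_le (by simp) (by simp), mul_comm, ENNReal.le_rpow_inv_iff h0]
  exact ENNReal.le_tsum n

/-- Riesz–Fischer: a rapidly Cauchy sequence converges almost everywhere, and Fatou turns its Cauchy
estimates into estimates of the distance to the pointwise limit. -/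
instance LpMap.instCompleteSpace [CompleteSpace Y] : CompleteSpace (LpMap μ p ξ) := by
  have h0 : 0 < p := lt_of_lt_of_le one_pos hp.out
  refine EMetric.complete_of_convergent_controlled_sequences (fun n => (4 ^ n)⁻¹)
    (fun n => by simp) fun a ha => ?_
  have hC := ae_cauchySeq_of_lpDist_le (fun n => (a n).1)
    fun n => (ha n n (n + 1) le_rfl n.le_succ).le
  obtain ⟨g, hg, hlim⟩ := exists_stronglyMeasurable_limit_of_tendsto_ae
    (fun n => (a n).1.aestronglyMeasurable) (hC.mono fun x hx => cauchySeq_tendsto_of_complete hx)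
  set c : M →ₘ[μ] Y := AEEqFun.mk g hg.aestronglyMeasurable with hc
  have hlim' : ∀ᵐ x ∂μ, Tendsto (fun n => (a n).1 x) atTop (𝓝 (c x)) := by
    filter_upwards [hlim, AEEqFun.coeFn_mk g hg.aestronglyMeasurable] with x h1 h2
    rw [hc, h2]; exact h1
  have hle : ∀ N, lpDist μ p (a N).1 c ≤ (4 ^ N)⁻¹ := fun N =>
    lpDist_le_of_tendsto_ae h0 _ _ _ hlim'
      ((eventually_ge_atTop N).mono fun m hm => (ha N N m le_rfl hm).le)
  have hcξ : lpDist μ p c ξ < ⊤ := by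
    refine (lpDist_triangle μ p hp.out c (a 0).1 ξ).trans_lt (ENNReal.add_lt_top.2 ⟨?_, (a 0).2⟩)
    rw [lpDist_comm]
    exact (hle 0).trans_lt (by simp)
  refine ⟨⟨c, hcξ⟩, tendsto_iff_edist_tendsto_0.2 ?_⟩
  refine tendsto_of_tendsto_of_tendsto_of_le_of_le tendsto_const_nhds
    (h := fun n => ((4 : ℝ≥0∞) ^ n)⁻¹) ?_ (fun n => zero_le) hle
  simp_rw [ENNReal.inv_pow]
  exact ENNReal.tendsto_pow_atTop_nhds_zero_of_lt_one (by simp)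

end LpMaps

/-! ### Uniqueness of Γ-limits; subnets from cluster points. -/

section Convergence

theorem exists_eventually_le_of_limsup_lt_top {ι : Type*} {l : Filter ι} {g : ι → ℝ≥0∞}
    (h : limsup g l < ⊤) :
    ∃ C : ℝ≥0∞, C ≠ ⊤ ∧ ∀ᶠ i in l, g i ≤ C := by
  obtain ⟨C, h1, h2⟩ := exists_between h
  exact ⟨C, h2.ne, (eventually_lt_of_limsup_lt h1).mono fun i hi => hi.le⟩

variable {ι : Type w} [Preorder ι] [IsDirectedOrder ι] [Nonempty ι] {X : Type u} [MetricSpace X]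

/-- `Γ`-limits along a given net are unique. -/
theorem GammaConverges.unique {F : ι → X → ℝ≥0∞} {E E' : X → ℝ≥0∞} (h : GammaConverges F E)
    (h' : GammaConverges F E') : E = E' := by
  have key : ∀ {E E' : X → ℝ≥0∞}, GammaConverges F E → GammaConverges F E' → ∀ x, E x ≤ E' x := by
    intro E E' h h' x
    obtain ⟨a, h1, h2⟩ := h'.1 x
    exact (h.2 x a h1).trans h2.liminf_eq.le
  exact funext fun x => (key h h' x).antisymm (key h' h x)

theorem hasConvergentSubnet_of_mapClusterPt {a : ι → X} {x : X} (h : MapClusterPt x atTop a) :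
    HasConvergentSubnet a := by
  have key : ∀ (i : ι) (n : ℕ), ∃ j, i ≤ j ∧ dist (a j) x < 1 / ((n : ℝ) + 1) := by
    intro i n
    have := (h.frequently (Metric.ball_mem_nhds x (Nat.one_div_pos_of_nat (n := n)))).and_eventually
      (eventually_ge_atTop i)
    obtain ⟨j, h1, h2⟩ := this.exists
    exact ⟨j, h2, h1⟩
  -- Neighbourhoods of `x` are indexed by `ℕ` rather than by sets, so that the subnet's index stays
  -- in the universe of `ι`.
  let J : Type w := {q : ι × ℕ // dist (a q.1) x < 1 / ((q.2 : ℝ) + 1)}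
  have exJ : ∀ (i : ι) (n : ℕ), ∃ q : J, i ≤ q.1.1 ∧ n ≤ q.1.2 := fun i n => by
    obtain ⟨j, h1, h2⟩ := key i n
    exact ⟨⟨(j, n), h2⟩, h1, le_rfl⟩
  have hdir : IsDirectedOrder J := ⟨fun q q' => by
    obtain ⟨i, hi, hi'⟩ := exists_ge_ge q.1.1 q'.1.1
    obtain ⟨r, h1, h2⟩ := exJ i (max q.1.2 q'.1.2)
    exact ⟨r, ⟨hi.trans h1, (le_max_left _ _).trans h2⟩, ⟨hi'.trans h1, (le_max_right _ _).trans h2⟩⟩⟩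
  have hne : Nonempty J := ⟨(exJ (Classical.arbitrary ι) 0).choose⟩
  refine ⟨J, inferInstance, hdir, hne, fun q => q.1.1, ?_, x, ?_⟩
  · refine tendsto_atTop.2 fun i => ?_
    obtain ⟨q, hq, -⟩ := exJ i 0
    exact (eventually_ge_atTop q).mono fun r hr => hq.trans hr.1
  · rw [Metric.tendsto_nhds]
    intro ε hε
    obtain ⟨n, hn⟩ := exists_nat_one_div_lt hε
    obtain ⟨q, -, hq⟩ := exJ (Classical.arbitrary ι) n
    refine (eventually_ge_atTop q).mono fun r hr => (r.2.trans_le ?_).trans hn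
    have : n ≤ r.1.2 := hq.trans hr.2
    gcongr

end Convergence

/-! ### Lower semicontinuity of the approximating energies and Γ-convergence. -/

section Energy

variable {M : Type u} {Y : Type v} [MetricSpace M] [MeasurableSpace M] [MetricSpace Y]

/-- The properties of the denominators `h_ρ(x, y) = ρ` and `h_ρ(x, y) = d(x, y)` used below. -/
structure IsScale (h : ℝ → M → M → ℝ) : Prop where
  measurable : ∀ ρ, Measurable fun q : M × M => h ρ q.1 q.2
  pos : ∀ {ρ x y}, 0 < ρ → y ≠ x → 0 < h ρ x y
  le : ∀ {ρ x y}, dist y x < ρ → h ρ x y ≤ ρ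

theorem isScale_of_eq [SecondCountableTopology M] [BorelSpace M] {h : ℝ → M → M → ℝ}
    (hh : h = (fun ρ _ _ => ρ) ∨ h = fun _ x y => dist x y) : IsScale h := by
  rcases hh with rfl | rfl
  · exact ⟨fun ρ => measurable_const, fun h _ => h, fun _ => le_rfl⟩
  · exact ⟨fun ρ => measurable_dist, fun _ h => dist_pos.2 h.symm,
      fun h => by rw [dist_comm]; exact h.le⟩

variable {μ : Measure M} {p : ℝ} {b : M → ℝ → ℝ} {h : ℝ → M → M → ℝ} {ρ : ℝ}

theorem measurableSet_punctured_ball [SecondCountableTopology M] [BorelSpace M] (ρ : ℝ) :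
    MeasurableSet {q : M × M | q.2 ∈ Metric.ball q.1 ρ \ {q.1}} :=
  (measurableSet_lt (measurable_snd.dist measurable_fst) measurable_const).diff
    (measurableSet_eq_fun measurable_snd measurable_fst)

theorem measurable_energyDensity [SecondCountableTopology M] [BorelSpace M] [SFinite μ]
    (hb : Measurable fun x => b x ρ) (hh : IsScale h) (f : M →ₘ[μ] Y) :
    Measurable fun x => energyDensity μ p b h ρ f x := by
  refine hb.ennreal_ofReal.inv.mul ?_
  have h1 : Measurable fun q : M × M =>
      (edist (f q.1) (f q.2) / ENNReal.ofReal (h ρ q.1 q.2)) ^ p :=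
    ((((f.stronglyMeasurable.comp_measurable measurable_fst).edist
      (f.stronglyMeasurable.comp_measurable measurable_snd)).measurable).div
      (hh.measurable ρ).ennreal_ofReal).pow_const p
  have h2 := (h1.indicator (measurableSet_punctured_ball ρ)).lintegral_prod_right' (ν := μ)
  convert h2 using 2 with x
  rw [← lintegral_indicator (Metric.isOpen_ball.measurableSet.diff (measurableSet_singleton x))]
  rfl

/-- Fatou's lemma for the approximating energies. -/
theorem approxEnergy_le_liminf_of_tendsto_ae [SecondCountableTopology M] [BorelSpace M]
    [SFinite μ] (hρ : 0 < ρ)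
    (hb0 : ∀ x, 0 < b x ρ) (hb : Measurable fun x => b x ρ) (hh : IsScale h) (f : M →ₘ[μ] Y)
    (v : ℕ → M →ₘ[μ] Y) (hv : ∀ᵐ x ∂μ, Tendsto (fun n => v n x) atTop (𝓝 (f x))) :
    approxEnergy μ p b h ρ f ≤ liminf (fun n => approxEnergy μ p b h ρ (v n)) atTop := by
  unfold approxEnergy
  rw [ENNReal.liminf_const_mul_of_ne_top (by simp)]
  gcongr
  refine le_trans (lintegral_mono_ae ?_)
    (lintegral_liminf_le fun n => measurable_energyDensity hb hh (v n))
  filter_upwards [hv] with x hx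
  unfold energyDensity
  rw [ENNReal.liminf_const_mul_of_ne_top (by simp [hb0 x])]
  gcongr
  refine le_trans ?_ (lintegral_liminf_le fun n => ?_)
  · refine lintegral_mono_ae ?_
    filter_upwards [ae_restrict_of_ae hv, ae_restrict_mem
      (Metric.isOpen_ball.measurableSet.diff (measurableSet_singleton x))] with y hy hyx
    refine ((ENNReal.continuous_rpow_const.tendsto _).comp
      (ENNReal.Tendsto.div_const (hx.edist hy) (Or.inr ?_))).liminf_eq.ge
    simpa using hh.pos hρ hyx.2
  · refine Measurable.pow_const (Measurable.div ?_ ?_) p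
    · exact (stronglyMeasurable_const.edist (v n).stronglyMeasurable).measurable
    · exact ((hh.measurable ρ).comp measurable_prodMk_left).ennreal_ofReal

/-- Sequences suffice in a metric space. One violating the inequality has an almost everywhere
convergent subsequence, which contradicts Fatou. -/
theorem lowerSemicontinuous_approxEnergy [SecondCountableTopology M] [BorelSpace M]
    [SFinite μ] [Fact (1 ≤ p)] (hρ : 0 < ρ) (hb0 : ∀ x, 0 < b x ρ)
    (hb : Measurable fun x => b x ρ) (hh : IsScale h) (ξ : M →ₘ[μ] Y) :
    LowerSemicontinuous fun u : LpMap μ p ξ => approxEnergy μ p b h ρ u.1 := by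
  intro u c hc
  by_contra hn
  rw [not_eventually] at hn
  obtain ⟨a, ha, hac⟩ := exists_seq_forall_of_frequently hn
  obtain ⟨n, -, hae⟩ := LpMap.exists_subseq_tendsto_ae ha
  refine (hc.trans_le (approxEnergy_le_liminf_of_tendsto_ae hρ hb0 hb hh u.1 _ hae)).not_ge ?_
  exact liminf_le_of_frequently_le' (Frequently.of_forall fun k => not_lt.1 (hac (n k)))

theorem ConditionM.exists_tendsto (hM : ConditionM Y μ p b h) (f : M →ₘ[μ] Y) :
    ∃ e, Tendsto (fun ρ => approxEnergy μ p b h ρ f) (𝓝[>] 0) (𝓝 e) := by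
  obtain ⟨Θ, hΘ0, hΘ, H⟩ := hM
  set e := liminf (fun ρ => approxEnergy μ p b h ρ f) (𝓝[>] 0) with he
  have hΘ' : Tendsto (fun R => ENNReal.ofReal (Θ R)) (𝓝[>] 0) (𝓝 1) := by
    simpa using ENNReal.tendsto_ofReal hΘ
  have h1 : ∀ R : ℝ, 0 < R → approxEnergy μ p b h R f ≤ ENNReal.ofReal (Θ R) * e := by
    intro R hR
    rw [he, ← ENNReal.liminf_const_mul_of_ne_top ENNReal.ofReal_ne_top]
    refine le_liminf_of_le (by isBoundedDefault) ?_
    filter_upwards [Ioo_mem_nhdsGT (half_pos hR)] with ρ hρ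
    exact H ρ R hρ.1 hρ.2.le f
  refine ⟨e, tendsto_of_le_liminf_of_limsup_le le_rfl ?_⟩
  rcases eq_or_ne e ⊤ with h | h
  · rw [h]; exact le_top
  · have h2 : Tendsto (fun R => ENNReal.ofReal (Θ R) * e) (𝓝[>] 0) (𝓝 e) := by
      simpa using ENNReal.Tendsto.mul_const hΘ' (Or.inr h)
    rw [← h2.limsup_eq]
    exact limsup_le_limsup (eventually_mem_nhdsWithin.mono h1)

/-- The scale `R` is frozen while the net moves: semicontinuity applies to the single functional
`E^R`, and (M) compares it with `E^{ρ_i}` as soon as `ρ_i ≤ R/2`. -/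
theorem ConditionM.gammaConverges [SecondCountableTopology M] [BorelSpace M]
    [SFinite μ] [Fact (1 ≤ p)] (hM : ConditionM Y μ p b h) (hb0 : ∀ x r, 0 < r → 0 < b x r)
    (hb : ∀ r, 0 < r → Measurable fun x => b x r) (hh : IsScale h) {E : (M →ₘ[μ] Y) → ℝ≥0∞}
    (hE : ∀ f, Tendsto (fun ρ => approxEnergy μ p b h ρ f) (𝓝[>] 0) (𝓝 (E f)))
    {ι : Type w} [Preorder ι] [IsDirectedOrder ι] [Nonempty ι] {ρ : ι → ℝ} (hρ : ∀ i, 0 < ρ i)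
    (hρ0 : Tendsto ρ atTop (𝓝 0)) (ξ : M →ₘ[μ] Y) :
    GammaConverges (fun i (u : LpMap μ p ξ) => approxEnergy μ p b h (ρ i) u.1)
      (fun u : LpMap μ p ξ => E u.1) := by
  have hρ' : Tendsto ρ atTop (𝓝[>] 0) :=
    tendsto_nhdsWithin_iff.2 ⟨hρ0, Eventually.of_forall hρ⟩
  refine ⟨fun u => ⟨fun _ => u, tendsto_const_nhds, (hE u.1).comp hρ'⟩, fun u a ha => ?_⟩
  obtain ⟨Θ, hΘ0, hΘ, H⟩ := hM
  set l := liminf (fun i => approxEnergy μ p b h (ρ i) (a i).1) atTop with hl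
  rcases eq_or_ne l ⊤ with h' | h'
  · rw [h']; exact le_top
  have h1 : ∀ R : ℝ, 0 < R → approxEnergy μ p b h R u.1 ≤ ENNReal.ofReal (Θ R) * l := by
    intro R hR
    rw [hl, ← ENNReal.liminf_const_mul_of_ne_top ENNReal.ofReal_ne_top]
    have h2 := LowerSemicontinuousAt.le_liminf (lowerSemicontinuous_approxEnergy (p := p) hR
      (fun x => hb0 x R hR) (hb R hR) hh ξ u)
    have h3 := h2.trans (liminf_le_liminf_of_le ha)
    refine h3.trans ?_
    rw [show liminf _ (map a atTop) = liminf (_ ∘ a) atTop from (liminf_comp _ _ _).symm]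
    refine liminf_le_liminf ?_
    filter_upwards [hρ0.eventually_le_const (half_pos hR)] with i hi
    exact H _ _ (hρ i) hi _
  have h2 : Tendsto (fun R => ENNReal.ofReal (Θ R) * l) (𝓝[>] 0) (𝓝 l) := by
    simpa using ENNReal.Tendsto.mul_const (ENNReal.tendsto_ofReal hΘ) (Or.inr h')
  exact le_of_tendsto_of_tendsto (hE u.1) h2 (eventually_mem_nhdsWithin.mono h1)

end Energy

/-! ### Estimates at a fixed scale. -/

theorem add_add_rpow_le {p : ℝ} (hp : 0 < p) (a b c : ℝ≥0∞) :
    (a + b + c) ^ p ≤ 3 ^ p * (a ^ p + b ^ p + c ^ p) := by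
  have h1 : a + b + c ≤ 3 * max (max a b) c := by
    calc a + b + c ≤ max (max a b) c + max (max a b) c + max (max a b) c := by
          gcongr <;> simp
      _ = _ := by ring
  calc (a + b + c) ^ p ≤ (3 * max (max a b) c) ^ p := ENNReal.rpow_le_rpow h1 hp.le
    _ = 3 ^ p * (max (max a b) c) ^ p := ENNReal.mul_rpow_of_nonneg _ _ hp.le
    _ ≤ _ := by
      gcongr
      rcases max_choice (max a b) c with h | h <;> rw [h]
      · rcases max_choice a b with h | h <;> rw [h]
        · exact le_add_right (le_add_right le_rfl)
        · exact le_add_right (le_add_left le_rfl)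
      · exact le_add_left le_rfl

/-- Every ball of radius `R` contains one of finitely many balls of radius `R/2`, each of positive
measure. -/
theorem exists_pos_le_measure_ball {M : Type*} [MetricSpace M] [CompactSpace M]
    [MeasurableSpace M] (μ : Measure M) [μ.IsOpenPosMeasure] {R : ℝ} (hR : 0 < R) :
    ∃ β : ℝ≥0∞, β ≠ 0 ∧ ∀ x, β ≤ μ (Metric.ball x R) := by
  obtain ⟨t, -, ht, hcov⟩ := (isCompact_univ (X := M)).finite_cover_balls (half_pos hR)
  obtain ⟨t, rfl⟩ := ht.exists_finset_coe
  refine ⟨t.inf fun c => μ (Metric.ball c (R / 2)), ?_, fun x => ?_⟩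
  · refine ne_of_gt ((Finset.lt_inf_iff (by simp)).2 fun c _ => ?_)
    exact Metric.measure_ball_pos μ c (half_pos hR)
  · obtain ⟨c, hc, hx⟩ := Set.mem_iUnion₂.1 (hcov (Set.mem_univ x))
    refine (Finset.inf_le hc).trans (measure_mono (Metric.ball_subset_ball' ?_))
    have := Metric.mem_ball'.1 hx
    linarith

section Energy

variable {M : Type u} {Y : Type v} [MetricSpace M] [MeasurableSpace M] [MetricSpace Y]
  {μ : Measure M} {p : ℝ} {b : M → ℝ → ℝ} {h : ℝ → M → M → ℝ} {R : ℝ}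

/-- The two-sided volume bounds at a fixed scale `R`. -/
structure VolumeBound (μ : Measure M) (b : M → ℝ → ℝ) (R κ : ℝ) (β : ℝ≥0∞) : Prop where
  scale_pos : 0 < R
  pos : ∀ x, 0 < b x R
  measurable : Measurable fun x => b x R
  nonneg : 0 ≤ κ
  lower : ∀ x, ENNReal.ofReal (κ * b x R) ≤ μ (Metric.ball x R)
  upper : ∀ x, μ (Metric.ball x R) ≤ ENNReal.ofReal (b x R)
  ne_zero : β ≠ 0
  le : ∀ x, β ≤ μ (Metric.ball x R)

variable {κ : ℝ} {β : ℝ≥0∞}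

theorem VolumeBound.inv_le (H : VolumeBound μ b R κ β) (x : M) :
    (ENNReal.ofReal (b x R))⁻¹ ≤ β⁻¹ :=
  ENNReal.inv_le_inv.2 ((H.le x).trans (H.upper x))

theorem VolumeBound.inv_mul_le (H : VolumeBound μ b R κ β) (x : M) :
    (ENNReal.ofReal (b x R))⁻¹ * μ (Metric.ball x R) ≤ 1 := by
  rw [mul_comm, ← div_eq_mul_inv]
  exact ENNReal.div_le_of_le_mul (by simpa using H.upper x)

/-- Used to replace a quantity at `x` by its average over the ball, at the cost of `κ`, before the
triangle inequality is applied under the integral. -/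
theorem VolumeBound.mul_le (H : VolumeBound μ b R κ β) (x : M) (c : ℝ≥0∞) :
    ENNReal.ofReal κ * c ≤ (ENNReal.ofReal (b x R))⁻¹ * ∫⁻ _y in Metric.ball x R, c ∂μ := by
  rw [setLIntegral_const, mul_left_comm, mul_comm c]
  gcongr
  rw [mul_comm, ← div_eq_mul_inv, ENNReal.le_div_iff_mul_le (by simp [H.pos x]) (by simp),
    ← ENNReal.ofReal_mul H.nonneg]
  exact H.lower x

theorem lintegral_energyDensity_eq (f : M →ₘ[μ] Y) :
    ∫⁻ x, energyDensity μ p b h R f x ∂μ = 2 * approxEnergy μ p b h R f := by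
  rw [approxEnergy, ← mul_assoc, ENNReal.mul_inv_cancel (by simp) (by simp), one_mul]

theorem lintegral_add_three_le {α : Type*} [MeasurableSpace α] {ν : Measure α}
    {f g k : α → ℝ≥0∞} (hf : Measurable f) (hg : Measurable g) :
    ∫⁻ x, (f x + g x + k x) ∂ν = ∫⁻ x, f x ∂ν + ∫⁻ x, g x ∂ν + ∫⁻ x, k x ∂ν := by
  rw [lintegral_add_left (f := fun x => f x + g x) (hf.add hg), lintegral_add_left hf]

variable [SecondCountableTopology M] [BorelSpace M]

/-- The denominator is at most `R` on the ball, and the removed centre contributes `0` to the left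
side. -/
theorem setLIntegral_ball_edist_rpow_le (hp : 0 < p) (hR : 0 < R) (hh : IsScale h) (f : M → Y)
    (x : M) :
    (ENNReal.ofReal (b x R))⁻¹ * ∫⁻ y in Metric.ball x R, edist (f x) (f y) ^ p ∂μ ≤
      ENNReal.ofReal R ^ p * energyDensity μ p b h R f x := by
  have hR0 : ENNReal.ofReal R ^ p ≠ ⊤ := ENNReal.rpow_ne_top_of_nonneg hp.le ENNReal.ofReal_ne_top
  unfold energyDensity
  rw [mul_left_comm]
  gcongr
  rw [← lintegral_const_mul' _ _ hR0, ← lintegral_indicator Metric.isOpen_ball.measurableSet,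
    ← lintegral_indicator (Metric.isOpen_ball.measurableSet.diff (measurableSet_singleton x))]
  refine lintegral_mono fun y => ?_
  by_cases hy : y ∈ Metric.ball x R
  · by_cases hyx : y = x
    · subst hyx
      rw [Set.indicator_of_mem hy]
      simp [hp]
    · rw [Set.indicator_of_mem hy, Set.indicator_of_mem (show y ∈ Metric.ball x R \ {x} from ⟨hy, hyx⟩),
        ← ENNReal.mul_rpow_of_nonneg _ _ hp.le]
      refine ENNReal.rpow_le_rpow ?_ hp.le
      have h1 : ENNReal.ofReal (h R x y) ≤ ENNReal.ofReal R := ENNReal.ofReal_le_ofReal (hh.le hy)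
      calc edist (f x) (f y)
          = ENNReal.ofReal R * (edist (f x) (f y) / ENNReal.ofReal R) := by
            rw [ENNReal.mul_div_cancel (by simpa using hR) ENNReal.ofReal_ne_top]
        _ ≤ _ := by gcongr
  · rw [Set.indicator_of_notMem hy]
    exact zero_le

/-- Local integrals of `d(u, v)^p` are controlled by the energies at scale `R` and the measure of
the domain of integration. -/
theorem setLIntegral_edist_rpow_le [SFinite μ] (hp : 0 < p) (H : VolumeBound μ b R κ β)
    (hh : IsScale h) (u v : M →ₘ[μ] Y) (T : Set M) :
    ENNReal.ofReal κ * ∫⁻ x in T, edist (u x) (v x) ^ p ∂μ ≤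
      3 ^ p * (ENNReal.ofReal R ^ p * (2 * approxEnergy μ p b h R u) +
        ENNReal.ofReal R ^ p * (2 * approxEnergy μ p b h R v) +
        β⁻¹ * (∫⁻ y, edist (u y) (v y) ^ p ∂μ) * μ T) := by
  have h3 : (3 : ℝ≥0∞) ^ p ≠ ⊤ := ENNReal.rpow_ne_top_of_nonneg hp.le (by simp)
  have hRp : ENNReal.ofReal R ^ p ≠ ⊤ := ENNReal.rpow_ne_top_of_nonneg hp.le ENNReal.ofReal_ne_top
  have hdist : ∀ f : M →ₘ[μ] Y, ∀ x, Measurable fun y => edist (f x) (f y) ^ p := fun f x =>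
    (stronglyMeasurable_const.edist f.stronglyMeasurable).measurable.pow_const p
  have key : ∀ x, ENNReal.ofReal κ * edist (u x) (v x) ^ p ≤
      3 ^ p * (ENNReal.ofReal R ^ p * energyDensity μ p b h R u x +
        ENNReal.ofReal R ^ p * energyDensity μ p b h R v x +
        β⁻¹ * ∫⁻ y, edist (u y) (v y) ^ p ∂μ) := by
    intro x
    refine (H.mul_le x _).trans ?_
    -- The path from `u x` to `v x` goes through `u y` and `v y`; the outer legs are paid for by the
    -- energies, the middle one by the global `L^p`-distance.
    calc _ ≤ (ENNReal.ofReal (b x R))⁻¹ * ∫⁻ y in Metric.ball x R, 3 ^ p *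
            (edist (u x) (u y) ^ p + edist (v x) (v y) ^ p + edist (u y) (v y) ^ p) ∂μ := by
          gcongr with y
          refine le_trans (ENNReal.rpow_le_rpow ?_ hp.le) (add_add_rpow_le hp _ _ _)
          calc edist (u x) (v x) ≤ edist (u x) (u y) + edist (u y) (v y) + edist (v y) (v x) :=
                edist_triangle4 _ _ _ _
            _ = _ := by rw [edist_comm (v y)]; ring
      _ = 3 ^ p * ((ENNReal.ofReal (b x R))⁻¹ * ∫⁻ y in Metric.ball x R, edist (u x) (u y) ^ p ∂μ +
            (ENNReal.ofReal (b x R))⁻¹ * ∫⁻ y in Metric.ball x R, edist (v x) (v y) ^ p ∂μ +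
            (ENNReal.ofReal (b x R))⁻¹ * ∫⁻ y in Metric.ball x R, edist (u y) (v y) ^ p ∂μ) := by
          rw [lintegral_const_mul' _ _ h3, lintegral_add_three_le (hdist u x) (hdist v x)]
          ring
      _ ≤ _ := by
          refine mul_le_mul_right (add_le_add_three ?_ ?_ ?_) _
          · exact setLIntegral_ball_edist_rpow_le hp H.scale_pos hh u x
          · exact setLIntegral_ball_edist_rpow_le hp H.scale_pos hh v x
          · exact mul_le_mul' (H.inv_le x) (setLIntegral_le_lintegral _ _)
  have hE : ∀ f : M →ₘ[μ] Y, ∫⁻ x in T, ENNReal.ofReal R ^ p * energyDensity μ p b h R f x ∂μ ≤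
      ENNReal.ofReal R ^ p * (2 * approxEnergy μ p b h R f) := fun f => by
    rw [lintegral_const_mul' _ _ hRp, ← lintegral_energyDensity_eq]
    gcongr
    exact Measure.restrict_le_self
  have hm : ∀ f : M →ₘ[μ] Y, Measurable fun x =>
      ENNReal.ofReal R ^ p * energyDensity μ p b h R f x := fun f =>
    (measurable_energyDensity H.measurable hh f).const_mul _
  rw [← lintegral_const_mul' _ _ ENNReal.ofReal_ne_top]
  refine (lintegral_mono key).trans ?_
  rw [lintegral_const_mul' _ _ h3, lintegral_add_three_le (hm u) (hm v), setLIntegral_const]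
  gcongr
  · exact hE u
  · exact hE v

end Energy

/-! ### Truncated distances, smoothed balls and closeness in measure. -/

section Truncation

variable {M : Type u} {Y : Type v} [MetricSpace M] [MetricSpace Y]

/-- The distance truncated at `1`. -/
noncomputable def truncDist (s t : Y) : ℝ≥0∞ := min (edist s t) 1

theorem truncDist_le_one (s t : Y) : truncDist s t ≤ 1 := min_le_right _ _

theorem truncDist_le_edist (s t : Y) : truncDist s t ≤ edist s t := min_le_left _ _

theorem truncDist_comm (s t : Y) : truncDist s t = truncDist t s := by
  rw [truncDist, truncDist, edist_comm]

theorem truncDist_triangle (s t r : Y) : truncDist s r ≤ truncDist s t + truncDist t r := by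
  unfold truncDist
  rcases le_total (edist s t) 1 with h | h
  · rcases le_total (edist t r) 1 with h' | h'
    · rw [min_eq_left h, min_eq_left h']
      exact (min_le_left _ _).trans (edist_triangle _ _ _)
    · rw [min_eq_right h']
      exact (min_le_right _ _).trans le_add_self
  · rw [min_eq_right h]
    exact (min_le_right _ _).trans le_self_add

theorem truncDist_le_add_edist (s s' t : Y) : truncDist s t ≤ truncDist s' t + edist s s' :=
  (truncDist_triangle s s' t).trans (by rw [add_comm]; gcongr; exact truncDist_le_edist _ _)

/-- Either `d ≤ r`, or `d = d^{1-p} d^p` with `d^{1-p} ≤ r^{1-p}` because `1 - p ≤ 0`. Taking `r =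
R` later makes both terms of order `R`. -/
theorem truncDist_le_rpow {p : ℝ} (hp : 1 ≤ p) {r : ℝ≥0∞} (h0 : r ≠ 0) (s t : Y) :
    truncDist s t ≤ r + r ^ (1 - p) * edist s t ^ p := by
  refine (truncDist_le_edist s t).trans ?_
  rcases le_total (edist s t) r with h | h
  · exact h.trans le_self_add
  · refine le_trans ?_ le_add_self
    have h0' : edist s t ≠ 0 := fun h' => h0 (le_antisymm (h'.symm ▸ h) zero_le)
    calc edist s t = edist s t ^ (1 - p) * edist s t ^ p := by
          rw [← ENNReal.rpow_add _ _ h0' (edist_ne_top _ _)]; simp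
      _ ≤ _ := by
          refine mul_le_mul_left ?_ _
          rw [← neg_sub, ENNReal.rpow_neg, ENNReal.rpow_neg, ENNReal.inv_le_inv]
          exact ENNReal.rpow_le_rpow h (by linarith)

section

variable {M : Type u} [MeasurableSpace M] {μ : Measure M}

theorem measurable_truncDist (s : Y) (f : M →ₘ[μ] Y) : Measurable fun y => truncDist s (f y) :=
  (stronglyMeasurable_const.edist f.stronglyMeasurable).measurable.min measurable_const

theorem measurable_truncDist_aeEqFun (f g : M →ₘ[μ] Y) :
    Measurable fun x => truncDist (f x) (g x) :=
  (measurable_edist_aeEqFun f g).min measurable_const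

end

/-- Cut-off functions, Lipschitz in the centre, that increase to the indicator function of the
ball of radius `R`. -/
noncomputable def cutoff (R : ℝ) (n : ℕ) (x y : M) : ℝ≥0∞ :=
  ENNReal.ofReal (min 1 (n * (R - dist y x)))

theorem cutoff_le_one (R : ℝ) (n : ℕ) (x y : M) : cutoff R n x y ≤ 1 := by
  rw [cutoff, ENNReal.ofReal_le_one]
  exact min_le_left _ _

theorem cutoff_eq_zero {R : ℝ} (n : ℕ) {x y : M} (h : y ∉ Metric.ball x R) :
    cutoff R n x y = 0 := by
  rw [cutoff, ENNReal.ofReal_eq_zero]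
  refine (min_le_right _ _).trans (mul_nonpos_of_nonneg_of_nonpos (by positivity) ?_)
  have := not_lt.1 (Metric.mem_ball.not.1 h)
  linarith

theorem cutoff_eq_one {R : ℝ} {n : ℕ} {x y : M} (h : 1 ≤ n * (R - dist y x)) :
    cutoff R n x y = 1 := by
  rw [cutoff, min_eq_left h, ENNReal.ofReal_one]

theorem cutoff_le_add (R : ℝ) (n : ℕ) (x x' y : M) :
    cutoff R n x y ≤ cutoff R n x' y + ENNReal.ofReal (n * dist x x') := by
  unfold cutoff
  refine le_trans (ENNReal.ofReal_le_ofReal ?_) ENNReal.ofReal_add_le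
  have h1 : dist y x' ≤ dist y x + dist x x' := dist_triangle _ _ _
  have h2 : (0 : ℝ) ≤ n * dist x x' := by positivity
  have h3 : (n : ℝ) * (R - dist y x) ≤ n * (R - dist y x') + n * dist x x' := by
    rw [← mul_add]
    gcongr
    linarith
  rcases le_total 1 ((n : ℝ) * (R - dist y x')) with h | h
  · rw [min_eq_left h]
    exact (min_le_left _ _).trans (by linarith)
  · rw [min_eq_right h]
    exact (min_le_right _ _).trans h3

/-- The set where the cut-off function differs from the indicator function of the ball. -/
def cutoffAnnulus (M : Type*) [MetricSpace M] (R : ℝ) (n : ℕ) : Set (M × M) :=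
  {q | dist q.2 q.1 < R ∧ n * (R - dist q.2 q.1) < 1}

variable [MeasurableSpace M] {μ : Measure M} {p : ℝ}

/-- The integral of `y ↦ τ(s, f(y))`, `τ` the truncated distance, against a cut-off function. -/
noncomputable def cutoffIntegral (μ : Measure M) (R : ℝ) (n : ℕ) (f : M → Y) (x : M) (s : Y) :
    ℝ≥0∞ :=
  ∫⁻ y, cutoff R n x y * truncDist s (f y) ∂μ

theorem cutoffIntegral_le_univ (R : ℝ) (n : ℕ) (f : M → Y) (x : M) (s : Y) :
    cutoffIntegral μ R n f x s ≤ μ Set.univ := by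
  rw [← lintegral_one]
  exact lintegral_mono fun y => mul_le_one' (cutoff_le_one _ _ _ _) (truncDist_le_one _ _)

/-- The constants do not depend on `f`: this is the equicontinuity behind the Arzelà–Ascoli
argument. -/
theorem cutoffIntegral_le_add (R : ℝ) (n : ℕ) (f : M → Y) (x x' : M) (s s' : Y) :
    cutoffIntegral μ R n f x s ≤ cutoffIntegral μ R n f x' s' +
      (ENNReal.ofReal (n * dist x x') + edist s s') * μ Set.univ := by
  unfold cutoffIntegral
  rw [← lintegral_const, ← lintegral_add_right _ measurable_const]
  refine lintegral_mono fun y => ?_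
  calc cutoff R n x y * truncDist s (f y)
      ≤ (cutoff R n x' y + ENNReal.ofReal (n * dist x x')) * truncDist s (f y) := by
        gcongr; exact cutoff_le_add _ _ _ _ _
    _ = cutoff R n x' y * truncDist s (f y) +
        ENNReal.ofReal (n * dist x x') * truncDist s (f y) := add_mul _ _ _
    _ ≤ cutoff R n x' y * (truncDist s' (f y) + edist s s') +
        ENNReal.ofReal (n * dist x x') * 1 := by
        gcongr
        · exact truncDist_le_add_edist _ _ _
        · exact truncDist_le_one _ _
    _ ≤ cutoff R n x' y * truncDist s' (f y) + 1 * edist s s' +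
        ENNReal.ofReal (n * dist x x') * 1 := by
        rw [mul_add]
        gcongr
        exact cutoff_le_one _ _ _ _
    _ = _ := by ring

variable [BorelSpace M]

theorem cutoffIntegral_le_setLIntegral (R : ℝ) (n : ℕ) (f : M → Y) (x : M) (s : Y) :
    cutoffIntegral μ R n f x s ≤ ∫⁻ y in Metric.ball x R, truncDist s (f y) ∂μ := by
  rw [← lintegral_indicator Metric.isOpen_ball.measurableSet]
  refine lintegral_mono fun y => ?_
  by_cases hy : y ∈ Metric.ball x R
  · rw [Set.indicator_of_mem hy]
    exact mul_le_of_le_one_left' (cutoff_le_one _ _ _ _)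
  · simp [cutoff_eq_zero n hy]

variable [SecondCountableTopology M]

theorem measurableSet_cutoffAnnulus (R : ℝ) (n : ℕ) : MeasurableSet (cutoffAnnulus M R n) :=
  (measurableSet_lt (measurable_snd.dist measurable_fst) measurable_const).inter
    (measurableSet_lt ((measurable_const.sub (measurable_snd.dist measurable_fst)).const_mul _)
      measurable_const)

theorem setLIntegral_le_cutoffIntegral_add (R : ℝ) (n : ℕ) (f : M → Y) (x : M) (s : Y) :
    ∫⁻ y in Metric.ball x R, truncDist s (f y) ∂μ ≤
      cutoffIntegral μ R n f x s + μ (Prod.mk x ⁻¹' cutoffAnnulus M R n) := by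
  have hm : MeasurableSet (Prod.mk x ⁻¹' cutoffAnnulus M R n) :=
    measurable_prodMk_left (measurableSet_cutoffAnnulus R n)
  rw [← lintegral_indicator Metric.isOpen_ball.measurableSet, ← lintegral_indicator_one hm,
    cutoffIntegral, ← lintegral_add_right _ (measurable_one.indicator hm)]
  refine lintegral_mono fun y => ?_
  by_cases hy : y ∈ Metric.ball x R
  · rw [Set.indicator_of_mem hy]
    by_cases hy' : y ∈ Prod.mk x ⁻¹' cutoffAnnulus M R n
    · rw [Set.indicator_of_mem hy']
      exact (truncDist_le_one _ _).trans le_add_self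
    · rw [cutoff_eq_one, one_mul]
      · exact le_self_add
      · by_contra hlt
        exact hy' ⟨hy, not_le.1 hlt⟩
  · rw [Set.indicator_of_notMem hy]
    exact zero_le

/-- The annuli decrease to the empty set in the product, whose measure is finite. -/
theorem tendsto_measure_cutoffAnnulus [IsFiniteMeasure μ] (R : ℝ) :
    Tendsto (fun n => ∫⁻ x, μ (Prod.mk x ⁻¹' cutoffAnnulus M R n) ∂μ) atTop (𝓝 0) := by
  simp_rw [← Measure.prod_apply (measurableSet_cutoffAnnulus R _)]
  have h1 : ⋂ n, cutoffAnnulus M R n = ∅ := by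
    refine Set.eq_empty_of_forall_notMem fun q hq => ?_
    rw [Set.mem_iInter] at hq
    have hpos : 0 < R - dist q.2 q.1 := sub_pos.2 (hq 0).1
    obtain ⟨n, hn⟩ := exists_nat_ge (1 / (R - dist q.2 q.1))
    exact (hq n).2.not_ge ((div_le_iff₀ hpos).1 hn)
  have h2 : Antitone (cutoffAnnulus M R) := fun m n hmn q hq => ⟨hq.1, lt_of_le_of_lt
    (mul_le_mul_of_nonneg_right (Nat.cast_le.2 hmn) (sub_pos.2 hq.1).le) hq.2⟩
  have := tendsto_measure_iInter_atTop (μ := μ.prod μ)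
    (fun n => (measurableSet_cutoffAnnulus (M := M) R n).nullMeasurableSet) h2
    ⟨0, measure_ne_top _ _⟩
  rw [h1, measure_empty] at this
  exact this

variable {b : M → ℝ → ℝ} {h : ℝ → M → M → ℝ} {R κ : ℝ} {β : ℝ≥0∞}

theorem setLIntegral_truncDist_le (hp : 1 ≤ p) (H : VolumeBound μ b R κ β)
    (hh : IsScale h) (f : M →ₘ[μ] Y) (x : M) :
    (ENNReal.ofReal (b x R))⁻¹ * ∫⁻ y in Metric.ball x R, truncDist (f x) (f y) ∂μ ≤
      ENNReal.ofReal R + ENNReal.ofReal R * energyDensity μ p b h R f x := by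
  have h0 : 0 < p := by linarith
  have hR : ENNReal.ofReal R ≠ 0 := by simpa using H.scale_pos
  have hR' : ENNReal.ofReal R ^ (1 - p) ≠ ⊤ := by
    simp [hR]
  calc _ ≤ (ENNReal.ofReal (b x R))⁻¹ * ∫⁻ y in Metric.ball x R, (ENNReal.ofReal R +
          ENNReal.ofReal R ^ (1 - p) * edist (f x) (f y) ^ p) ∂μ := by
        gcongr with y
        exact truncDist_le_rpow hp hR _ _
    _ = ENNReal.ofReal R * ((ENNReal.ofReal (b x R))⁻¹ * μ (Metric.ball x R)) +
          ENNReal.ofReal R ^ (1 - p) * ((ENNReal.ofReal (b x R))⁻¹ *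
            ∫⁻ y in Metric.ball x R, edist (f x) (f y) ^ p ∂μ) := by
        rw [lintegral_add_left measurable_const, setLIntegral_const,
          lintegral_const_mul' _ _ hR']
        ring
    _ ≤ ENNReal.ofReal R * 1 + ENNReal.ofReal R ^ (1 - p) * (ENNReal.ofReal R ^ p *
          energyDensity μ p b h R f x) := by
        refine add_le_add (mul_le_mul_right (H.inv_mul_le x) _) (mul_le_mul_right ?_ _)
        exact setLIntegral_ball_edist_rpow_le h0 H.scale_pos hh f x
    _ = _ := by
        rw [mul_one, ← mul_assoc, ← ENNReal.rpow_add _ _ hR ENNReal.ofReal_ne_top]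
        simp

/-- Two maps whose cut-off integrals are close and whose energies at scale `R` are bounded are
close in measure. -/
theorem lintegral_truncDist_le [IsFiniteMeasure μ] (hp : 1 ≤ p) (H : VolumeBound μ b R κ β)
    (hh : IsScale h) (f g : M →ₘ[μ] Y) {K : Set Y} (hK : IsClosed K) (n : ℕ) {η : ℝ≥0∞}
    (hη : ∀ x, ∀ s ∈ K, cutoffIntegral μ R n g x s ≤ cutoffIntegral μ R n f x s + η) :
    ENNReal.ofReal κ * ∫⁻ x, truncDist (f x) (g x) ∂μ ≤
      ENNReal.ofReal R * (μ Set.univ + 2 * approxEnergy μ p b h R g) +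
        ENNReal.ofReal R * (μ Set.univ + 2 * approxEnergy μ p b h R f) +
        (β⁻¹ * (η * μ Set.univ + ∫⁻ x, μ (Prod.mk x ⁻¹' cutoffAnnulus M R n) ∂μ) +
          μ {x | f x ∉ K}) := by
  have hKm : MeasurableSet {x | f x ∉ K} :=
    (by borelize Y; exact (f.stronglyMeasurable.measurable hK.measurableSet).compl)
  have key : ∀ x, ENNReal.ofReal κ * truncDist (f x) (g x) ≤
      (ENNReal.ofReal R + ENNReal.ofReal R * energyDensity μ p b h R g x) +
      (ENNReal.ofReal R + ENNReal.ofReal R * energyDensity μ p b h R f x) +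
      (β⁻¹ * (η + μ (Prod.mk x ⁻¹' cutoffAnnulus M R n)) +
        {x | f x ∉ K}.indicator 1 x) := by
    intro x
    refine (H.mul_le x _).trans ?_
    calc _ ≤ (ENNReal.ofReal (b x R))⁻¹ * ∫⁻ y in Metric.ball x R,
            (truncDist (g x) (g y) + truncDist (f x) (g y)) ∂μ := by
          gcongr with y
          rw [add_comm, truncDist_comm (g x)]
          exact truncDist_triangle _ _ _
      _ = (ENNReal.ofReal (b x R))⁻¹ * ∫⁻ y in Metric.ball x R, truncDist (g x) (g y) ∂μ +
          (ENNReal.ofReal (b x R))⁻¹ * ∫⁻ y in Metric.ball x R, truncDist (f x) (g y) ∂μ := by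
          rw [lintegral_add_left (measurable_truncDist _ g), mul_add]
      _ ≤ _ := by
          rw [add_assoc]
          refine add_le_add (setLIntegral_truncDist_le hp H hh g x) ?_
          -- On `K` the hypothesis `hη` exchanges `g` for `f` at `s = f x`; off `K` the truncated
          -- distance is bounded by `1`.
          by_cases hx : f x ∈ K
          · refine le_trans ?_ (add_le_add_right le_self_add _)
            refine le_trans ?_ (add_le_add (setLIntegral_truncDist_le hp H hh f x)
              (mul_le_mul_left (H.inv_le x) _))
            rw [← mul_add]
            gcongr
            refine (setLIntegral_le_cutoffIntegral_add R n g x (f x)).trans ?_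
            rw [← add_assoc]
            gcongr
            refine (hη x _ hx).trans ?_
            gcongr
            exact cutoffIntegral_le_setLIntegral R n f x (f x)
          · refine le_trans ?_ le_add_self
            refine le_trans ?_ le_add_self
            rw [Set.indicator_of_mem (show x ∈ {x | f x ∉ K} from hx)]
            refine le_trans ?_ (H.inv_mul_le x)
            gcongr
            rw [← setLIntegral_one]
            exact lintegral_mono fun y => truncDist_le_one _ _
  have hm : ∀ k : M →ₘ[μ] Y, Measurable fun x =>
      ENNReal.ofReal R + ENNReal.ofReal R * energyDensity μ p b h R k x := fun k =>
    ((measurable_energyDensity H.measurable hh k).const_mul _).const_add _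
  have hE : ∀ k : M →ₘ[μ] Y,
      ∫⁻ x, (ENNReal.ofReal R + ENNReal.ofReal R * energyDensity μ p b h R k x) ∂μ =
      ENNReal.ofReal R * (μ Set.univ + 2 * approxEnergy μ p b h R k) := fun k => by
    rw [lintegral_add_left measurable_const, lintegral_const,
      lintegral_const_mul' _ _ ENNReal.ofReal_ne_top, lintegral_energyDensity_eq, mul_add]
  by_cases hμ : Nonempty M
  · have hβ : β⁻¹ ≠ ⊤ := by simpa using H.ne_zero
    rw [← lintegral_const_mul' _ _ ENNReal.ofReal_ne_top]
    refine (lintegral_mono key).trans ?_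
    rw [lintegral_add_three_le (hm g) (hm f), hE, hE,
      lintegral_add_right _ (measurable_one.indicator hKm), lintegral_indicator_one hKm,
      lintegral_const_mul' _ _ hβ, lintegral_add_left measurable_const, lintegral_const]
  · have := not_nonempty_iff.1 hμ
    simp [lintegral_of_isEmpty]

end Truncation

/-! ### Cauchy estimates along an ultrafilter. -/

section Compactness

variable {M : Type u} {Y : Type v} [MetricSpace M] [MeasurableSpace M] [MetricSpace Y]
  {μ : Measure M} [IsFiniteMeasure μ] {p : ℝ} {b : M → ℝ → ℝ} {h : ℝ → M → M → ℝ}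
  {ι : Type w} {U : Ultrafilter ι}

theorem tendsto_ofReal_mul_nhdsGT_zero {c : ℝ≥0∞} (hc : c ≠ ⊤) :
    Tendsto (fun r : ℝ => ENNReal.ofReal r * c) (𝓝[>] 0) (𝓝 0) := by
  have h1 : Tendsto ENNReal.ofReal (𝓝[>] 0) (𝓝 0) := by
    simpa using (ENNReal.continuous_ofReal.tendsto 0).mono_left nhdsWithin_le_nhds
  simpa using ENNReal.Tendsto.mul_const h1 (Or.inr hc)

/-- Along an ultrafilter the cut-off integrals are uniformly Cauchy on compact sets. -/
theorem eventually_cutoffIntegral_le [CompactSpace M] (R : ℝ) (n : ℕ) (f : ι → M → Y) {K : Set Y}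
    (hK : IsCompact K) {η : ℝ≥0∞} (hη : η ≠ 0) :
    ∀ᶠ q in (U : Filter ι) ×ˢ (U : Filter ι), ∀ x, ∀ s ∈ K,
      cutoffIntegral μ R n (f q.2) x s ≤ cutoffIntegral μ R n (f q.1) x s + η := by
  -- Four errors: two for moving to the nearby net point `(c, d)` and back, two for comparing with
  -- the limit there.
  have h4 : η / 4 ≠ 0 := by simp [hη]
  have hlim : ∀ x s, ∃ l : ℝ≥0∞,
      Tendsto (fun i => cutoffIntegral μ R n (f i) x s) U (𝓝 l) := fun x s =>
    ⟨_, (U.map fun i => cutoffIntegral μ R n (f i) x s).le_nhds_lim⟩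
  choose l hl using hlim
  have hl' : ∀ x s, ∀ᶠ i in (U : Filter ι), cutoffIntegral μ R n (f i) x s ≤ l x s + η / 4 ∧
      l x s ≤ cutoffIntegral μ R n (f i) x s + η / 4 := fun x s => by
    have hfin : l x s ≠ ⊤ := ne_top_of_le_ne_top (measure_ne_top μ Set.univ)
      (le_of_tendsto (hl x s) (Eventually.of_forall fun i => cutoffIntegral_le_univ _ _ _ _ _))
    filter_upwards [(ENNReal.tendsto_nhds hfin).1 (hl x s) _ (pos_iff_ne_zero.2 h4)] with i hi
    exact ⟨hi.2, tsub_le_iff_right.1 hi.1⟩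
  obtain ⟨δ, hδ, hδ0⟩ : ∃ δ : ℝ,
      ENNReal.ofReal δ * (((n : ℝ≥0∞) + 1) * μ Set.univ) ≤ η / 4 ∧ 0 < δ := by
    have := tendsto_ofReal_mul_nhdsGT_zero (c := ((n : ℝ≥0∞) + 1) * μ Set.univ)
      (ENNReal.mul_ne_top (by simp) (measure_ne_top _ _))
    exact ((this.eventually_le_const (pos_iff_ne_zero.2 h4)).and
      eventually_mem_nhdsWithin).exists
  have hclose : ∀ x c : M, ∀ s d : Y, dist x c < δ → dist s d < δ →
      (ENNReal.ofReal (n * dist x c) + edist s d) * μ Set.univ ≤ η / 4 := by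
    intro x c s d h1 h2
    refine le_trans ?_ hδ
    rw [← mul_assoc, mul_add, mul_one, mul_comm (ENNReal.ofReal δ), ENNReal.ofReal_mul n.cast_nonneg,
      ENNReal.ofReal_natCast, edist_dist]
    gcongr
  obtain ⟨t, -, ht, htc⟩ := (isCompact_univ (X := M)).finite_cover_balls hδ0
  obtain ⟨t', -, ht', htc'⟩ := hK.finite_cover_balls hδ0
  have hS : ∀ᶠ i in (U : Filter ι), ∀ c ∈ t, ∀ d ∈ t',
      cutoffIntegral μ R n (f i) c d ≤ l c d + η / 4 ∧
      l c d ≤ cutoffIntegral μ R n (f i) c d + η / 4 :=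
    (eventually_all_finite ht).2 fun c _ => (eventually_all_finite ht').2 fun d _ => hl' c d
  filter_upwards [hS.prod_mk hS] with q hq x s hs
  obtain ⟨c, hc, hxc⟩ := Set.mem_iUnion₂.1 (htc (Set.mem_univ x))
  obtain ⟨d, hd, hsd⟩ := Set.mem_iUnion₂.1 (htc' hs)
  rw [Metric.mem_ball] at hxc hsd
  calc cutoffIntegral μ R n (f q.2) x s
      ≤ cutoffIntegral μ R n (f q.2) c d + η / 4 :=
        (cutoffIntegral_le_add _ _ _ _ _ _ _).trans (by gcongr; exact hclose _ _ _ _ hxc hsd)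
    _ ≤ l c d + η / 4 + η / 4 := by gcongr; exact (hq.2 c hc d hd).1
    _ ≤ cutoffIntegral μ R n (f q.1) c d + η / 4 + η / 4 + η / 4 := by
        gcongr; exact (hq.1 c hc d hd).2
    _ ≤ cutoffIntegral μ R n (f q.1) x s + η / 4 + η / 4 + η / 4 + η / 4 := by
        gcongr
        refine (cutoffIntegral_le_add _ _ _ _ x _ s).trans ?_
        gcongr
        exact hclose _ _ _ _ (by rwa [dist_comm]) (by rwa [dist_comm])
    _ = cutoffIntegral μ R n (f q.1) x s + 4 * (η / 4) := by ring
    _ = _ := by rw [ENNReal.mul_div_cancel (by simp) (by simp)]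

/-- An `L^p`-bounded family of maps is tight. -/
theorem exists_isCompact_measure_notMem_le {M : Type u} [MeasurableSpace M]
    {μ : Measure M} [IsFiniteMeasure μ] [ProperSpace Y] (hp : 0 < p) (o : M →ₘ[μ] Y) {C : ℝ≥0∞}
    (hC : C ≠ ⊤) {ε : ℝ≥0∞} (hε : ε ≠ 0) :
    ∃ K : Set Y, IsCompact K ∧ ∀ f : M →ₘ[μ] Y, lpDist μ p f o ≤ C → μ {x | f x ∉ K} ≤ ε := by
  cases isEmpty_or_nonempty M with
  | inl hM => exact ⟨∅, isCompact_empty, fun f _ => by simp [Set.eq_empty_of_isEmpty]⟩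
  | inr hM =>
    obtain ⟨x₀⟩ := hM
    set y₀ : Y := o x₀
    have h2 : 0 < ε / 2 := pos_iff_ne_zero.2 (by simp [hε])
    have hlim1 : Tendsto (fun N : ℕ => μ {x | (N : ℝ≥0∞) ≤ edist (o x) y₀}) atTop (𝓝 0) := by
      have hm : Measurable fun x => edist (o x) y₀ :=
        (o.stronglyMeasurable.edist stronglyMeasurable_const).measurable
      have hempty : ⋂ N : ℕ, {x | (N : ℝ≥0∞) ≤ edist (o x) y₀} = ∅ := by
        refine Set.eq_empty_of_forall_notMem fun x hx => ?_
        obtain ⟨N, hN⟩ := ENNReal.exists_nat_gt (edist_ne_top (o x) y₀)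
        exact (Set.mem_iInter.1 hx N).not_gt hN
      have := tendsto_measure_iInter_atTop (μ := μ)
        (s := fun N : ℕ => {x | (N : ℝ≥0∞) ≤ edist (o x) y₀})
        (fun N => (measurableSet_le measurable_const hm).nullMeasurableSet)
        (fun m n hmn x (hx : (n : ℝ≥0∞) ≤ _) => show (m : ℝ≥0∞) ≤ _ from
          le_trans (Nat.cast_le.2 hmn) hx) ⟨0, measure_ne_top _ _⟩
      rwa [hempty, measure_empty] at this
    have hlim2 : Tendsto (fun N : ℕ => C ^ p / (N : ℝ≥0∞) ^ p) atTop (𝓝 0) := by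
      have h3 : Tendsto (fun N : ℕ => (N : ℝ≥0∞) ^ p) atTop (𝓝 ⊤) :=
        ((ENNReal.tendsto_rpow_at_top hp).comp ENNReal.tendsto_nat_nhds_top)
      simpa using ENNReal.Tendsto.const_div h3 (Or.inr (ENNReal.rpow_ne_top_of_nonneg hp.le hC))
    obtain ⟨N, ⟨hN1, hN2⟩, hN3⟩ := (((hlim1.eventually_le_const h2).and
      (hlim2.eventually_le_const h2)).and (eventually_ge_atTop 1)).exists
    refine ⟨Metric.closedBall y₀ (2 * N), isCompact_closedBall _ _, fun f hf => ?_⟩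
    have hsub : {x | f x ∉ Metric.closedBall y₀ (2 * N)} ⊆
        {x | (N : ℝ≥0∞) ≤ edist (o x) y₀} ∪ {x | (N : ℝ≥0∞) ≤ edist (f x) (o x)} := by
      intro x hx
      by_contra hn
      simp only [Set.mem_union, Set.mem_ofPred_eq, not_or, not_le] at hn
      refine hx ?_
      rw [Metric.mem_closedBall]
      have e1 : ∀ s t : Y, edist s t < N → dist s t < N := fun s t hst => by
        rw [← ENNReal.ofReal_natCast, edist_lt_ofReal] at hst
        exact hst
      have := dist_triangle (f x) (o x) y₀
      linarith [e1 _ _ hn.1, e1 _ _ hn.2]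
    calc _ ≤ _ := measure_mono hsub
      _ ≤ _ := measure_union_le _ _
      _ ≤ ε / 2 + ε / 2 := by
        gcongr
        refine le_trans (measure_le_edist_le hp f o ?_ (by simp)) (le_trans ?_ hN2)
        · simp only [ne_eq, Nat.cast_eq_zero]
          omega
        · gcongr
      _ = ε := ENNReal.add_halves ε

variable [CompactSpace M] [BorelSpace M] {κ : ℝ} {f : ι → M →ₘ[μ] Y}
  {o : M →ₘ[μ] Y} {C C₀ : ℝ≥0∞}

/-- The scale `R` is fixed first, to make the two energy terms small; `β`, `n` and `η` may then
depend on `R`. There are five error terms, hence `α / 5`. -/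
theorem tendsto_lintegral_truncDist [ProperSpace Y] (hp : 1 ≤ p) (hh : IsScale h) (hκ : 0 < κ)
    (H : ∀ R, 0 < R → ∃ β, VolumeBound μ b R κ β) (hC : C ≠ ⊤)
    (hE : ∀ᶠ R in 𝓝[>] 0, ∀ᶠ i in (U : Filter ι), approxEnergy μ p b h R (f i) ≤ C)
    (hC₀ : C₀ ≠ ⊤) (ho : ∀ᶠ i in (U : Filter ι), lpDist μ p (f i) o ≤ C₀) :
    Tendsto (fun q : ι × ι => ∫⁻ x, truncDist (f q.1 x) (f q.2 x) ∂μ)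
      ((U : Filter ι) ×ˢ (U : Filter ι)) (𝓝 0) := by
  have hκ0 : ENNReal.ofReal κ ≠ 0 := by simpa using hκ
  suffices hs : Tendsto (fun q : ι × ι => ENNReal.ofReal κ * ∫⁻ x, truncDist (f q.1 x) (f q.2 x) ∂μ)
      ((U : Filter ι) ×ˢ (U : Filter ι)) (𝓝 0) by
    have := ENNReal.Tendsto.const_mul (a := (ENNReal.ofReal κ)⁻¹) hs (Or.inr (by simpa using hκ))
    simpa [← mul_assoc, ENNReal.inv_mul_cancel hκ0 ENNReal.ofReal_ne_top] using this
  rw [ENNReal.tendsto_nhds_zero]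
  intro α hα
  have h5 : 0 < α / 5 := pos_iff_ne_zero.2 (by simp [hα.ne'])
  obtain ⟨R, ⟨hR, hER⟩, hR0⟩ := (((tendsto_ofReal_mul_nhdsGT_zero (c := μ Set.univ + 2 * C)
    (by simp [hC, ENNReal.mul_eq_top])).eventually_le_const h5).and hE).and
    eventually_mem_nhdsWithin |>.exists
  obtain ⟨β, HR⟩ := H R hR0
  have hβ : β⁻¹ ≠ ⊤ := by simpa using HR.ne_zero
  obtain ⟨K, hK, hKle⟩ := exists_isCompact_measure_notMem_le (lt_of_lt_of_le one_pos hp) o hC₀ h5.ne'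
  obtain ⟨n, hn⟩ : ∃ n, β⁻¹ * ∫⁻ x, μ (Prod.mk x ⁻¹' cutoffAnnulus M R n) ∂μ ≤ α / 5 := by
    have := ENNReal.Tendsto.const_mul (a := β⁻¹) (tendsto_measure_cutoffAnnulus (μ := μ) R)
      (Or.inr hβ)
    rw [mul_zero] at this
    exact (this.eventually_le_const h5).exists
  obtain ⟨η, hη0, hη⟩ := ENNReal.exists_nnreal_pos_mul_lt
    (ENNReal.mul_ne_top hβ (measure_ne_top μ Set.univ)) h5.ne'
  have hη0' : (η : ℝ≥0∞) ≠ 0 := by simpa using hη0.ne'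
  have hS := hER.and ho
  filter_upwards [eventually_cutoffIntegral_le (μ := μ) (U := U) R n (fun i => f i) hK hη0',
    hS.prod_mk hS] with q hq1 hq2
  calc _ ≤ _ := lintegral_truncDist_le hp HR hh (f q.1) (f q.2) hK.isClosed n hq1
    _ ≤ α / 5 + α / 5 + (α / 5 + α / 5 + α / 5) := by
      rw [mul_add β⁻¹]
      gcongr
      · exact le_trans (by gcongr; exact hq2.2.1) hR
      · exact le_trans (by gcongr; exact hq2.1.1) hR
      · exact le_trans (le_of_eq (by ring)) hη.le
      · exact hKle _ hq2.1.2
    _ = 5 * (α / 5) := by ring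
    _ = α := ENNReal.mul_div_cancel (by simp) (by simp)

theorem eventually_setLIntegral_edist_rpow_le (hp : 1 ≤ p) (hh : IsScale h) (hκ : 0 < κ)
    (H : ∀ R, 0 < R → ∃ β, VolumeBound μ b R κ β) (hC : C ≠ ⊤)
    (hE : ∀ᶠ R in 𝓝[>] 0, ∀ᶠ i in (U : Filter ι), approxEnergy μ p b h R (f i) ≤ C)
    (hC₀ : C₀ ≠ ⊤) (ho : ∀ᶠ i in (U : Filter ι), lpDist μ p (f i) o ≤ C₀) {α : ℝ≥0∞}
    (hα : α ≠ 0) :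
    ∃ γ : ℝ≥0∞, γ ≠ 0 ∧ ∀ᶠ q in (U : Filter ι) ×ˢ (U : Filter ι), ∀ T : Set M, μ T ≤ γ →
      ∫⁻ x in T, edist (f q.1 x) (f q.2 x) ^ p ∂μ ≤ α := by
  have h0 : 0 < p := lt_of_lt_of_le one_pos hp
  have hκ0 : ENNReal.ofReal κ ≠ 0 := by simpa using hκ
  have h3 : (3 : ℝ≥0∞) ^ p ≠ ⊤ := ENNReal.rpow_ne_top_of_nonneg h0.le (by simp)
  have ha : 0 < ENNReal.ofReal κ * α / 3 := pos_iff_ne_zero.2 (by simp [hα, hκ])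
  obtain ⟨R, ⟨⟨hR, hR1⟩, hER⟩, hR0⟩ := ((((tendsto_ofReal_mul_nhdsGT_zero
    (c := 3 ^ p * (2 * C)) (ENNReal.mul_ne_top h3 (ENNReal.mul_ne_top (by simp)
    hC))).eventually_le_const ha).and (Ioo_mem_nhdsGT one_pos)).and hE).and
    eventually_mem_nhdsWithin |>.exists
  obtain ⟨β, HR⟩ := H R hR0
  have hβ : β⁻¹ ≠ ⊤ := by simpa using HR.ne_zero
  -- `R < 1` and `p ≥ 1` reduce smallness of `R^p` to smallness of `R`.
  have hRp : ENNReal.ofReal R ^ p ≤ ENNReal.ofReal R := by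
    calc _ ≤ ENNReal.ofReal R ^ (1 : ℝ) :=
          ENNReal.rpow_le_rpow_of_exponent_ge (ENNReal.ofReal_le_one.2 hR1.2.le) hp
      _ = _ := ENNReal.rpow_one _
  obtain ⟨γ, hγ0, hγ⟩ := ENNReal.exists_nnreal_pos_mul_lt (a := 3 ^ p * (β⁻¹ * (C₀ + C₀) ^ p))
    (ENNReal.mul_ne_top h3 (ENNReal.mul_ne_top hβ
      (ENNReal.rpow_ne_top_of_nonneg h0.le (by simp [hC₀])))) ha.ne'
  refine ⟨γ, by simpa using hγ0.ne', ?_⟩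
  have hS := hER.and ho
  filter_upwards [hS.prod_mk hS] with q hq T hT
  have hdist : ∫⁻ x, edist (f q.1 x) (f q.2 x) ^ p ∂μ ≤ (C₀ + C₀) ^ p := by
    rw [← lpDist_le_iff h0]
    refine (lpDist_triangle μ p hp _ o _).trans (add_le_add hq.1.2 ?_)
    rw [lpDist_comm]
    exact hq.2.2
  have hEle : ∀ k : M →ₘ[μ] Y, approxEnergy μ p b h R k ≤ C →
      3 ^ p * (ENNReal.ofReal R ^ p * (2 * approxEnergy μ p b h R k)) ≤
        ENNReal.ofReal κ * α / 3 := fun k hk => by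
    refine le_trans ?_ hR
    rw [mul_left_comm]
    gcongr
  refine (ENNReal.mul_le_mul_iff_right hκ0 ENNReal.ofReal_ne_top).1 ?_
  calc _ ≤ _ := setLIntegral_edist_rpow_le h0 HR hh (f q.1) (f q.2) T
    _ ≤ ENNReal.ofReal κ * α / 3 + ENNReal.ofReal κ * α / 3 + ENNReal.ofReal κ * α / 3 := by
      rw [mul_add, mul_add]
      refine add_le_add_three (hEle _ hq.1.1) (hEle _ hq.2.1) ?_
      calc _ ≤ 3 ^ p * (β⁻¹ * (C₀ + C₀) ^ p * γ) := by gcongr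
        _ = γ * (3 ^ p * (β⁻¹ * (C₀ + C₀) ^ p)) := by ring
        _ ≤ _ := hγ.le
    _ = 3 * (ENNReal.ofReal κ * α / 3) := by ring
    _ = _ := ENNReal.mul_div_cancel (by simp) (by simp)

/-- Along an ultrafilter, `L^p`-bounded maps whose energies at all small scales are eventually
bounded form a Cauchy filter. -/
theorem eventually_lpDist_le [ProperSpace Y] (hp : 1 ≤ p) (hh : IsScale h) (hκ : 0 < κ)
    (H : ∀ R, 0 < R → ∃ β, VolumeBound μ b R κ β) (hC : C ≠ ⊤)
    (hE : ∀ᶠ R in 𝓝[>] 0, ∀ᶠ i in (U : Filter ι), approxEnergy μ p b h R (f i) ≤ C)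
    (hC₀ : C₀ ≠ ⊤) (ho : ∀ᶠ i in (U : Filter ι), lpDist μ p (f i) o ≤ C₀) {ε : ℝ≥0∞}
    (hε : ε ≠ 0) :
    ∀ᶠ q in (U : Filter ι) ×ˢ (U : Filter ι), lpDist μ p (f q.1) (f q.2) ≤ ε := by
  have h0 : 0 < p := lt_of_lt_of_le one_pos hp
  simp_rw [lpDist_le_iff h0]
  have hε2 : ε ^ p / 2 ≠ 0 := by simp [hε, h0.le]
  obtain ⟨γ, hγ0, hγ⟩ := eventually_setLIntegral_edist_rpow_le hp hh hκ H hC hE hC₀ ho hε2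
  obtain ⟨θ', hθ'0, hθ'⟩ := ENNReal.exists_nnreal_pos_mul_lt (measure_ne_top μ Set.univ) hε2
  -- Where `d < θ`, the integral of `d^p` is at most `θ^p μ(M)`; `θ ≤ 1` gives `θ^p ≤ θ ≤ θ'`, and
  -- also lets the truncated distance detect `d ≥ θ`.
  set θ : ℝ≥0∞ := min θ' 1 with hθ
  have hθ0 : θ ≠ 0 := by simp [hθ, hθ'0.ne', min_eq_iff]
  have hθt : θ ≠ ⊤ := ne_top_of_le_ne_top ENNReal.one_ne_top (min_le_right _ _)
  have hθp : θ ^ p ≤ θ' := by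
    calc θ ^ p ≤ θ ^ (1 : ℝ) := ENNReal.rpow_le_rpow_of_exponent_ge (min_le_right _ _) hp
      _ = θ := ENNReal.rpow_one _
      _ ≤ θ' := min_le_left _ _
  -- The bound `γ θ` is what Chebyshev needs to give `{d ≥ θ}` measure at most `γ`.
  have hτ := (tendsto_lintegral_truncDist hp hh hκ H hC hE hC₀ ho).eventually_le_const
    (pos_iff_ne_zero.2 (mul_ne_zero hγ0 hθ0))
  filter_upwards [hγ, hτ] with q hq1 hq2
  have hTm : MeasurableSet {x | θ ≤ edist (f q.1 x) (f q.2 x)} :=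
    measurableSet_le measurable_const (measurable_edist_aeEqFun _ _)
  have hT : μ {x | θ ≤ edist (f q.1 x) (f q.2 x)} ≤ γ := by
    calc _ ≤ μ {x | θ ≤ truncDist (f q.1 x) (f q.2 x)} :=
          measure_mono fun x (hx : θ ≤ edist _ _) => show θ ≤ truncDist _ _ from
            le_min hx (min_le_right _ _)
      _ ≤ (∫⁻ x, truncDist (f q.1 x) (f q.2 x) ∂μ) / θ :=
          meas_ge_le_lintegral_div (measurable_truncDist_aeEqFun _ _).aemeasurable hθ0 hθt
      _ ≤ γ := ENNReal.div_le_of_le_mul hq2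
  rw [← lintegral_add_compl _ hTm]
  calc _ ≤ ε ^ p / 2 + ε ^ p / 2 := by
        refine add_le_add (hq1 _ hT) ?_
        calc _ ≤ ∫⁻ _x in {x | θ ≤ edist (f q.1 x) (f q.2 x)}ᶜ, θ ^ p ∂μ :=
              setLIntegral_mono measurable_const fun x hx =>
                ENNReal.rpow_le_rpow (not_le.1 (show ¬ θ ≤ edist _ _ from hx)).le h0.le
          _ ≤ θ ^ p * μ Set.univ := by
              rw [setLIntegral_const]
              gcongr
              exact Set.subset_univ _
          _ ≤ θ' * μ Set.univ := by gcongr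
          _ ≤ _ := hθ'.le
    _ = _ := ENNReal.add_halves _

end Compactness

/-! ### Asymptotic compactness from (M) and (AR). -/

section Compactness

variable {M : Type u} {Y : Type v} [MetricSpace M] [MeasurableSpace M] [MetricSpace Y]
  {μ : Measure M} {p : ℝ}
  {b : M → ℝ → ℝ} {h : ℝ → M → M → ℝ}

theorem ConditionAR.exists_volumeBound [CompactSpace M] [μ.IsOpenPosMeasure] (hAR : ConditionAR μ b)
    (hb0 : ∀ x r, 0 < r → 0 < b x r) (hb : ∀ r, 0 < r → Measurable fun x => b x r) :
    ∃ κ : ℝ, 0 < κ ∧ ∀ R, 0 < R → ∃ β, VolumeBound μ b R κ β := by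
  obtain ⟨κ, hκ, -, H⟩ := hAR
  refine ⟨κ, hκ, fun R hR => ?_⟩
  obtain ⟨β, hβ0, hβ⟩ := exists_pos_le_measure_ball μ hR
  exact ⟨β, hR, fun x => hb0 x R hR, hb R hR, hκ.le, fun x => (H x R hR).1,
    fun x => (H x R hR).2, hβ0, hβ⟩

/-- Condition (M) carries the bound from the moving scale `ρ i` up to each fixed small `R`; the
factor `2` is any constant above `lim Θ = 1`. -/
theorem ConditionM.eventually_approxEnergy_le (hM : ConditionM Y μ p b h) {ι : Type w}
    {l : Filter ι} {ρ : ι → ℝ} (hρ : ∀ i, 0 < ρ i) (hρ0 : Tendsto ρ l (𝓝 0))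
    {f : ι → M →ₘ[μ] Y} {C : ℝ≥0∞} (hC : ∀ᶠ i in l, approxEnergy μ p b h (ρ i) (f i) ≤ C) :
    ∀ᶠ R in 𝓝[>] 0, ∀ᶠ i in l, approxEnergy μ p b h R (f i) ≤ 2 * C := by
  obtain ⟨Θ, -, hΘ, H⟩ := hM
  filter_upwards [hΘ.eventually_le_const one_lt_two, eventually_mem_nhdsWithin] with R hR hR0
  filter_upwards [hC, hρ0.eventually_le_const (half_pos hR0)] with i hi hi'
  refine (H _ _ (hρ i) hi' _).trans ?_
  gcongr
  simpa using ENNReal.ofReal_le_ofReal hR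

theorem asymptoticallyCompact_approxEnergy [CompactSpace M] [BorelSpace M] [IsFiniteMeasure μ]
    [μ.IsOpenPosMeasure] [ProperSpace Y] [Fact (1 ≤ p)]
    (hM : ConditionM Y μ p b h) (hAR : ConditionAR μ b) (hb0 : ∀ x r, 0 < r → 0 < b x r)
    (hb : ∀ r, 0 < r → Measurable fun x => b x r) (hh : IsScale h)
    {ι : Type w} [Preorder ι] [IsDirectedOrder ι] [Nonempty ι] {ρ : ι → ℝ} (hρ : ∀ i, 0 < ρ i)
    (hρ0 : Tendsto ρ atTop (𝓝 0)) (ξ : M →ₘ[μ] Y) :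
    AsymptoticallyCompact
      (fun i (u : LpMap μ p ξ) => approxEnergy μ p b h (ρ i) u.1) := by
  rintro a ⟨o, x, hox, D, hD⟩ hlim
  obtain ⟨C, hC, haC⟩ := exists_eventually_le_of_limsup_lt_top hlim
  obtain ⟨κ, hκ, H⟩ := hAR.exists_volumeBound hb0 hb
  let U : Ultrafilter ι := Ultrafilter.of atTop
  have hU : (U : Filter ι) ≤ atTop := Ultrafilter.of_le atTop
  have hE := hM.eventually_approxEnergy_le hρ (hρ0.mono_left hU) (haC.filter_mono hU)
  have ho : ∀ᶠ i in (U : Filter ι), lpDist μ p (a i).1 x.1 ≤ ENNReal.ofReal D + 1 := by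
    filter_upwards [((tendsto_iff_edist_tendsto_0.1 hox).mono_left hU).eventually_le_const
      one_pos] with i hi
    refine (edist_triangle (a i) (o i) x).trans (add_le_add ?_ hi)
    rw [edist_dist]
    exact ENNReal.ofReal_le_ofReal (hD i)
  have hcauchy : Cauchy (map a U) := by
    refine cauchy_map_iff.2 ⟨inferInstance, ?_⟩
    refine uniformity_basis_edist_le.tendsto_right_iff.2 fun ε hε => ?_
    exact eventually_lpDist_le Fact.out hh hκ H (ENNReal.mul_ne_top (by simp) hC) hE (by simp) ho
      hε.ne'
  obtain ⟨y, hy⟩ := CompleteSpace.complete hcauchy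
  exact hasConvergentSubnet_of_mapClusterPt
    ((Tendsto.mapClusterPt (show Tendsto a U (𝓝 y) from hy)).mono hU)

end Compactness

end VarConv

theorem theorem6p1 {M : Type u} [MetricSpace M] [CompactSpace M] [MeasurableSpace M]
    [BorelSpace M] (μ : Measure M) [IsFiniteMeasure μ] [μ.IsOpenPosMeasure]
    {Y : Type v} [MetricSpace Y] [ProperSpace Y] (p : ℝ) [Fact (1 ≤ p)]
    (b : M → ℝ → ℝ) (hb_pos : ∀ x r, 0 < r → 0 < b x r)
    (hb_meas : ∀ r, 0 < r → Measurable fun x => b x r)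
    (h : ℝ → M → M → ℝ) (hh : h = (fun ρ _ _ => ρ) ∨ h = fun _ x y => dist x y)
    (f : ℝ → ℝ) (hf : f =o[𝓝[>] 0] fun r : ℝ => r ^ (-p))
    (hcov : VarConv.LocalCoveringOrderAtMost M 1 f)
    (hM : VarConv.ConditionM Y μ p b h) (hAR : VarConv.ConditionAR μ b) :
    ∃! E : (M →ₘ[μ] Y) → ℝ≥0∞,
      ∀ (ι : Type w) [Preorder ι] [IsDirectedOrder ι] [Nonempty ι] (ρ : ι → ℝ),
        (∀ i, 0 < ρ i) → Tendsto ρ atTop (𝓝 0) →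
          ∀ ξ : M →ₘ[μ] Y,
            VarConv.CompactlyConverges
              (fun i (u : VarConv.LpMap μ p ξ) => VarConv.approxEnergy μ p b h (ρ i) u.1)
              (fun u : VarConv.LpMap μ p ξ => E u.1) := by
  have hs := VarConv.isScale_of_eq hh
  choose E hE using fun u : M →ₘ[μ] Y => hM.exists_tendsto u
  have hconv : ∀ (ι : Type w) [Preorder ι] [IsDirectedOrder ι] [Nonempty ι] (ρ : ι → ℝ),
      (∀ i, 0 < ρ i) → Tendsto ρ atTop (𝓝 0) → ∀ ξ : M →ₘ[μ] Y,
        VarConv.CompactlyConverges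
          (fun i (u : VarConv.LpMap μ p ξ) => VarConv.approxEnergy μ p b h (ρ i) u.1)
          (fun u : VarConv.LpMap μ p ξ => E u.1) := fun ι _ _ _ ρ hρ hρ0 ξ =>
    ⟨hM.gammaConverges hb_pos hb_meas hs hE hρ hρ0 ξ,
      VarConv.asymptoticallyCompact_approxEnergy hM hAR hb_pos hb_meas hs hρ hρ0 ξ⟩
  refine ⟨E, hconv, fun E' hE' => funext fun u => ?_⟩
  -- One net suffices for uniqueness; the lift puts its index in universe `w`. The base map is taken
  -- to be `u` itself, so that `u` lies in the space.
  let ρ : ULift.{w} ℕ → ℝ := fun n => 1 / ((n.down : ℝ) + 1)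
  have hρ : ∀ i, 0 < ρ i := fun i => Nat.one_div_pos_of_nat
  have hdir : IsDirectedOrder (ULift.{w} ℕ) :=
    ⟨fun a c => ⟨⟨max a.down c.down⟩, le_max_left a.down c.down, le_max_right a.down c.down⟩⟩
  have hdown : Tendsto (ULift.down : ULift.{w} ℕ → ℕ) atTop atTop :=
    tendsto_atTop.2 fun n => (eventually_ge_atTop (ULift.up n)).mono fun m hm => hm
  have hρ0 : Tendsto ρ atTop (𝓝 0) := tendsto_one_div_add_atTop_nhds_zero_nat.comp hdown
  have hu : VarConv.lpDist μ p u u < ⊤ := by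
    rw [VarConv.lpDist_self μ p Fact.out]
    exact ENNReal.zero_lt_top
  exact congrFun (VarConv.GammaConverges.unique (hE' _ ρ hρ hρ0 u).1 (hconv _ ρ hρ hρ0 u).1)
    (⟨u, hu⟩ : VarConv.LpMap μ p u)
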